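/- Identify the plane $\mathbb R^2$ with $\mathbb C$. Let $A\neq B$ be points of the plane and let $a,b,c\colon[0,1]\to\mathbb R^2$ be three piecewise linear (PL) paths from $A$ to $B$ which have only general position intersections and self-intersections, that is: each of the three paths visits $A$ only at time $0$ and $B$ only at time $1$; away from these endpoints, no point of the plane is the image of more than two parameters (counted over the three paths together); and whenever two different parameters (of the same path or of two different paths), both in $(0,1)$, have the same image, both paths involved are affine near these parameters, with linearly independent directions. A point $x$ in the union of the traces $a([0,1])\cup b([0,1])\cup c([0,1])$ is called *strongly sheltered* if it lies on at least two of the three traces, or if it lies on just one of the traces and has odd winding number with respect to the loop determined by the remaining two paths. Here the loop determined by two paths $p,q$ from $A$ to $B$ is $p^-*q$, where $p^-(t)=p(1-t)$ and $*$ is concatenation (its orientation does not affect the parity). Then there exists a strongly sheltered path from $A$ to $B$ within the union of the traces of $a$, $b$ and $c$: there is a continuous path $\gamma\colon[0,1]\to a([0,1])\cup b([0,1])\cup c([0,1])$ with $\gamma(0)=A$ and $\gamma(1)=B$ such that every point $\gamma(t)$ is strongly sheltered. -/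

import Mathlib

/-- A path in the plane `ℝ² = ℂ` is piecewise linear if `[0, 1]` has a finite partition
`0 = τ 0 < τ 1 < ⋯ < τ n = 1` such that the path is affine on each `[τ i, τ (i + 1)]`. -/
def IsPLPath {A B : ℂ} (γ : Path A B) : Prop :=
  ∃ (n : ℕ) (τ : Fin (n + 1) → ℝ), StrictMono τ ∧ τ 0 = 0 ∧ τ (Fin.last n) = 1 ∧
    ∀ i : Fin n, ∃ u v : ℂ, ∀ t : unitInterval,
      τ i.castSucc ≤ (t : ℝ) → (t : ℝ) ≤ τ i.succ → γ t = u + (t : ℝ) • v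

/-- The path `γ` at time `s` and the path `δ` at time `t` both have a velocity, and these two
velocities are linearly independent over `ℝ`. For piecewise linear paths this says that both
paths are affine near those times (neither is at a bend) with non-parallel directions. -/
def TransverseAt {A B : ℂ} (γ δ : Path A B) (s t : unitInterval) : Prop :=
  ∃ v w : ℂ, HasDerivAt γ.extend v (s : ℝ) ∧ HasDerivAt δ.extend w (t : ℝ) ∧
    LinearIndependent ℝ ![v, w]

/-- A family of paths from `A` to `B` has only general position intersections and
self-intersections: the common endpoints are visited by each path only at its start and its end,
and, away from the endpoints, any two different parameters `(i, s) ≠ (j, t)` with the same image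
(so `i = j` is a self-intersection, `i ≠ j` an intersection of different paths) are a transverse
crossing, and no three different parameters have the same image. -/
structure InGeneralPosition {ι : Type*} {A B : ℂ} (p : ι → Path A B) : Prop where
  start_only : ∀ i t, p i t = A → t = 0
  end_only : ∀ i t, p i t = B → t = 1
  transverse : ∀ (i j : ι) (s t : unitInterval), s ∈ Set.Ioo 0 1 → t ∈ Set.Ioo 0 1 →
    (i, s) ≠ (j, t) → p i s = p j t → TransverseAt (p i) (p j) s t
  no_triple : ∀ (i j k : ι) (s t u : unitInterval),
    s ∈ Set.Ioo 0 1 → t ∈ Set.Ioo 0 1 → u ∈ Set.Ioo 0 1 →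
    (i, s) ≠ (j, t) → (j, t) ≠ (k, u) → (i, s) ≠ (k, u) → ¬ (p i s = p j t ∧ p j t = p k u)

/-- The loop `γ` avoids `x` and has winding number `k` about `x`: there is a continuous choice
`θ` of the logarithm of `γ - x` along `γ`, and it grows by `2 π i k` (that is, the argument grows
by `2 π k`) once around the loop. -/
def HasWindingNumber {P : ℂ} (γ : Path P P) (x : ℂ) (k : ℤ) : Prop :=
  ∃ θ : C(unitInterval, ℂ), (∀ t, γ t - x = Complex.exp (θ t)) ∧
    θ 1 - θ 0 = k * (2 * Real.pi * Complex.I)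

/-- The loop determined by two paths `a`, `b` from `A` to `B`: the inverse of `a`, then `b`. -/
noncomputable def loopOf {A B : ℂ} (a b : Path A B) : Path B B :=
  a.symm.trans b

/-- The point `x` lies on exactly the first of the three traces and has odd winding number with
respect to the loop determined by the other two paths. -/
def OddlyEnclosedOn {A B : ℂ} (a b c : Path A B) (x : ℂ) : Prop :=
  x ∈ Set.range a ∧ x ∉ Set.range b ∧ x ∉ Set.range c ∧
    ∃ k : ℤ, Odd k ∧ HasWindingNumber (loopOf b c) x k

/-- A point is strongly sheltered by `a`, `b`, `c` if it lies on at least two of the three traces,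
or on just one of them but with odd winding number with respect to the loop determined by the
remaining two paths. In particular it lies in the union of the three traces. -/
def StronglySheltered {A B : ℂ} (a b c : Path A B) (x : ℂ) : Prop :=
  (x ∈ Set.range a ∧ x ∈ Set.range b) ∨
  (x ∈ Set.range b ∧ x ∈ Set.range c) ∨
  (x ∈ Set.range a ∧ x ∈ Set.range c) ∨
  OddlyEnclosedOn a b c x ∨ OddlyEnclosedOn b a c x ∨ OddlyEnclosedOn c a b x

/-!
Call an arc of one path *enclosed* if the other two paths have odd winding number about its points.
The sheltered set `S` consists of the enclosed arcs and of the points where two different paths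
meet, and the claim is that `A` and `B` lie in the same path component of `S`. The proof is a
handshake argument on the graph formed by the enclosed arcs:

* Where two different paths cross, the winding number which decides about one of them
  changes by `± 1`, because this path crosses the loop formed by the other two
  (`turnSign_crossing`). So exactly one of the two branches of each path is enclosed there, and
  the crossing has degree two. A self-crossing of a path does not change the winding number which
  decides about it, so it can be ignored.
* At `A`, the number of enclosed initial arcs is odd (`prod_pairSign_near_start`). For `y` on the
  initial ray `A + ℝ≥0 u` of one path, the increment of `log (f - y)` along another path `f` with
  initial direction `v` is the sum of a term depending on `f` only, of a term depending on `y` only,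
  and of the principal value of `log (-v / u)` (`halfTurn_near_start`). In the cyclic sum of the
  three winding numbers the first two kinds of terms cancel, and the third kind, which is
  antisymmetric, leaves, up to sign, twice the sum of `log (-v / u)`, `log (-w / v)` and
  `log (-u / w)`. The product of these three negative quotients is `-1`, so this is an odd multiple
  of `2 π i`.

Let `g i` be the indicator function modulo `2` of the times at which path `i` is in the path
component of `A` in `S`. It is constant between crossings with other paths, and it jumps at such a
crossing by its value there (`joinInd_crossing`), so its total change is the sum of these values
(`eq_add_sum_of_jumps`). Every crossing point occurs twice in the sum over the three paths, so that
`∑ i, g i` is the same near time `1` as near time `0`, that is, odd. Hence one of the final arcs is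
enclosed and in the component of `A`, and this arc leads to `B`.

Winding numbers are handled through `halfTurn`, the exponential of half the increment of a
continuous logarithm, which turns parities into signs. Signs about nearby points `y` and `z` are
compared through `(f - y) / (f - z)`, which avoids the closed negative half-axis as long as `f`
avoids the segment from `y` to `z`. Piecewise linearity is used for the finiteness of the set of
crossings (`InGeneralPosition.finite_intersections`) and to have straight pieces at the endpoints
and near the crossings.
-/

/-! ### Increments of continuous logarithms -/

/-- `θ` is a continuous logarithm of `f` along the interval `[s, t]`. -/
def IsLogOn (θ f : ℝ → ℂ) (s t : ℝ) : Prop :=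
  ContinuousOn θ (Set.Icc s t) ∧ ∀ x ∈ Set.Icc s t, Complex.exp (θ x) = f x

theorem exists_isLogOn {f : ℝ → ℂ} {s t : ℝ} (hst : s ≤ t) (hf : ContinuousOn f (Set.Icc s t))
    (h0 : ∀ x ∈ Set.Icc s t, f x ≠ 0) : ∃ θ, IsLogOn θ f s t := by
  let F : C(ℝ, ℂ) := ⟨Set.IccExtend hst ((Set.Icc s t).domRestrict f),
    (continuousOn_iff_continuous_domRestrict.1 hf).Icc_extend'⟩
  have hF : ∀ x, F x ≠ 0 := fun x => h0 _ (Set.projIcc s t hst x).2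
  obtain ⟨θ, ⟨-, hθ⟩, -⟩ := Complex.isCoveringMapOn_exp.existsUnique_continuousMap_lifts F
    (a₀ := s) (Complex.exp_log (hF s)) (fun x => hF x)
  refine ⟨θ, θ.continuous.continuousOn, fun x hx => ?_⟩
  have h1 : Complex.exp (θ x) = F x := congrFun hθ x
  rw [h1]
  exact Set.IccExtend_of_mem hst ((Set.Icc s t).domRestrict f) hx

/-- Two continuous logarithms of the same function differ by a constant. -/
theorem IsLogOn.sub_eq_sub {θ η f : ℝ → ℂ} {s t : ℝ} (hst : s ≤ t) (h : IsLogOn θ f s t)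
    (k : IsLogOn η f s t) : θ t - θ s = η t - η s := by
  have hp : (2 * Real.pi * Complex.I : ℂ) ≠ 0 := Complex.two_pi_I_ne_zero
  have key : ∀ x ∈ Set.Icc s t, ∃ n : ℤ, (θ x - η x) / (2 * Real.pi * Complex.I) = n := by
    intro x hx
    obtain ⟨n, hn⟩ := Complex.exp_eq_exp_iff_exists_int.1 ((h.2 x hx).trans (k.2 x hx).symm)
    exact ⟨n, by rw [hn]; field_simp; ring⟩
  have hc := (isPreconnected_Icc (a := s) (b := t)).constant_of_mapsTo
    (T := Set.range ((↑) : ℤ → ℂ)) (f := fun x => (θ x - η x) / (2 * Real.pi * Complex.I))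
    ?_ ((h.1.sub k.1).div_const _) ?_ (Set.right_mem_Icc.2 hst) (Set.left_mem_Icc.2 hst)
  · have := (div_left_inj' hp).1 hc
    linear_combination this
  · exact Complex.isClosedEmbedding_intCast.isEmbedding.isDiscrete_range
  · intro x hx
    obtain ⟨n, hn⟩ := key x hx
    exact ⟨n, hn.symm⟩

theorem IsLogOn.mono {θ f : ℝ → ℂ} {s t s' t' : ℝ} (h : IsLogOn θ f s t) (hs : s ≤ s')
    (ht : t' ≤ t) : IsLogOn θ f s' t' :=
  ⟨h.1.mono (Set.Icc_subset_Icc hs ht), fun x hx => h.2 x (Set.Icc_subset_Icc hs ht hx)⟩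

open Classical in
/-- The increment of a continuous logarithm of `f` from `s` to `t` (with value `0` if there is no
such logarithm, for instance if `f` vanishes somewhere on `[s, t]`). -/
noncomputable def logIncr (f : ℝ → ℂ) (s t : ℝ) : ℂ :=
  if h : ∃ θ, IsLogOn θ f s t then h.choose t - h.choose s else 0

theorem IsLogOn.logIncr_eq {θ f : ℝ → ℂ} {s t : ℝ} (hst : s ≤ t) (h : IsLogOn θ f s t) :
    logIncr f s t = θ t - θ s := by
  have h' : ∃ θ, IsLogOn θ f s t := ⟨θ, h⟩
  rw [logIncr, dif_pos h']
  exact h'.choose_spec.sub_eq_sub hst h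

theorem logIncr_congr {f g : ℝ → ℂ} {s t : ℝ} (hst : s ≤ t) (hf : ContinuousOn f (Set.Icc s t))
    (h0 : ∀ x ∈ Set.Icc s t, f x ≠ 0) (hfg : ∀ x ∈ Set.Icc s t, f x = g x) :
    logIncr f s t = logIncr g s t := by
  obtain ⟨θ, hθ⟩ := exists_isLogOn hst hf h0
  rw [hθ.logIncr_eq hst, IsLogOn.logIncr_eq hst ⟨hθ.1, fun x hx => (hθ.2 x hx).trans (hfg x hx)⟩]

theorem logIncr_add {f : ℝ → ℂ} {s t u : ℝ} (hst : s ≤ t) (htu : t ≤ u)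
    (hf : ContinuousOn f (Set.Icc s u)) (h0 : ∀ x ∈ Set.Icc s u, f x ≠ 0) :
    logIncr f s t + logIncr f t u = logIncr f s u := by
  obtain ⟨θ, hθ⟩ := exists_isLogOn (hst.trans htu) hf h0
  rw [hθ.logIncr_eq (hst.trans htu), (hθ.mono le_rfl htu).logIncr_eq hst,
    (hθ.mono hst le_rfl).logIncr_eq htu]
  ring

theorem logIncr_mul {f g : ℝ → ℂ} {s t : ℝ} (hst : s ≤ t) (hf : ContinuousOn f (Set.Icc s t))
    (hf0 : ∀ x ∈ Set.Icc s t, f x ≠ 0) (hg : ContinuousOn g (Set.Icc s t))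
    (hg0 : ∀ x ∈ Set.Icc s t, g x ≠ 0) :
    logIncr (fun x => f x * g x) s t = logIncr f s t + logIncr g s t := by
  obtain ⟨θ, hθ⟩ := exists_isLogOn hst hf hf0
  obtain ⟨η, hη⟩ := exists_isLogOn hst hg hg0
  have : IsLogOn (fun x => θ x + η x) (fun x => f x * g x) s t :=
    ⟨hθ.1.add hη.1, fun x hx => by simp only [Complex.exp_add, hθ.2 x hx, hη.2 x hx]⟩
  rw [this.logIncr_eq hst, hθ.logIncr_eq hst, hη.logIncr_eq hst]
  ring

theorem logIncr_const {c : ℂ} (hc : c ≠ 0) {s t : ℝ} (hst : s ≤ t) :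
    logIncr (fun _ => c) s t = 0 := by
  have : IsLogOn (fun _ => Complex.log c) (fun _ => c) s t :=
    ⟨continuousOn_const, fun _ _ => Complex.exp_log hc⟩
  rw [this.logIncr_eq hst, sub_self]

theorem logIncr_of_mem_slitPlane {f : ℝ → ℂ} {s t : ℝ} (hst : s ≤ t)
    (hf : ContinuousOn f (Set.Icc s t)) (h : ∀ x ∈ Set.Icc s t, f x ∈ Complex.slitPlane) :
    logIncr f s t = Complex.log (f t) - Complex.log (f s) :=
  IsLogOn.logIncr_eq (θ := fun x => Complex.log (f x)) hst
    ⟨hf.clog h, fun x hx => Complex.exp_log (Complex.slitPlane_ne_zero (h x hx))⟩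

theorem logIncr_of_neg_mem_slitPlane {f : ℝ → ℂ} {s t : ℝ} (hst : s ≤ t)
    (hf : ContinuousOn f (Set.Icc s t)) (h : ∀ x ∈ Set.Icc s t, -f x ∈ Complex.slitPlane) :
    logIncr f s t = Complex.log (-f t) - Complex.log (-f s) := by
  have h1 := logIncr_of_mem_slitPlane (f := fun x => -f x) hst hf.neg h
  have h2 := logIncr_mul (f := fun _ => (-1 : ℂ)) (g := fun x => -f x) hst continuousOn_const
    (fun _ _ => by simp) hf.neg (fun x hx => Complex.slitPlane_ne_zero (h x hx))
  rw [logIncr_const (by simp) hst, zero_add] at h2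
  rw [← h1, ← h2]
  simp

theorem exp_logIncr {f : ℝ → ℂ} {s t : ℝ} (hst : s ≤ t)
    (hf : ContinuousOn f (Set.Icc s t)) (h0 : ∀ x ∈ Set.Icc s t, f x ≠ 0) :
    Complex.exp (logIncr f s t) = f t / f s := by
  obtain ⟨θ, hθ⟩ := exists_isLogOn hst hf h0
  rw [hθ.logIncr_eq hst, Complex.exp_sub, hθ.2 t (Set.right_mem_Icc.2 hst),
    hθ.2 s (Set.left_mem_Icc.2 hst)]

/-! ### Half-turns of a path about a point -/

/-- The square root of `(f 1 - x) / (f 0 - x)` reached by continuation along `f`: the exponential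
of half the increment of a logarithm of `f - x` over `[0, 1]`. For a loop `f` it is `(-1) ^ k`,
where `k` is the winding number about `x`. -/
noncomputable def halfTurn (f : ℝ → ℂ) (x : ℂ) : ℂ :=
  Complex.exp (logIncr (fun t => f t - x) 0 1 / 2)

theorem halfTurn_sq {f : ℝ → ℂ} (hf : Continuous f) {x : ℂ}
    (hx : ∀ t ∈ Set.Icc (0 : ℝ) 1, f t ≠ x) : halfTurn f x ^ 2 = (f 1 - x) / (f 0 - x) := by
  rw [halfTurn, ← Complex.exp_nat_mul, ← exp_logIncr zero_le_one (by fun_prop)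
    (fun t ht => sub_ne_zero.2 (hx t ht))]
  congr 1
  push_cast
  ring

theorem div_mem_slitPlane_of_notMem_segment {p y z : ℂ} (h : p ∉ segment ℝ y z) :
    (p - y) / (p - z) ∈ Complex.slitPlane := by
  have hz : p - z ≠ 0 := sub_ne_zero.2 fun e => h (e ▸ right_mem_segment ℝ y z)
  by_contra hs
  rw [Complex.mem_slitPlane_iff] at hs
  push Not at hs
  obtain ⟨hre, him⟩ := hs
  set r := ((p - y) / (p - z)).re with hr
  have hq : (p - y) / (p - z) = (r : ℂ) := Complex.ext (by simp [hr]) (by simpa using him)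
  rw [div_eq_iff hz] at hq
  have h1 : (0 : ℝ) < 1 - r := by linarith
  have h1' : (1 - r : ℂ) ≠ 0 := by exact_mod_cast h1.ne'
  refine h ⟨1 / (1 - r), -r / (1 - r), by positivity, div_nonneg (by linarith) h1.le, ?_, ?_⟩
  · field_simp
    ring
  · rw [Complex.real_smul, Complex.real_smul]
    push_cast
    field_simp
    linear_combination -hq

/-- The factor by which `halfTurn f` changes from `z` to `y` along a segment that the path `f`
from `A` to `B` avoids. It depends only on the endpoints of the path. -/
noncomputable def turnRatio (A B y z : ℂ) : ℂ :=
  Complex.exp ((Complex.log ((B - y) / (B - z)) - Complex.log ((A - y) / (A - z))) / 2)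

theorem logIncr_sub_eq {f : ℝ → ℂ} {s t : ℝ} (hst : s ≤ t) (hf : ContinuousOn f (Set.Icc s t))
    {y z : ℂ} (hy : ∀ x ∈ Set.Icc s t, f x ≠ y) (hz : ∀ x ∈ Set.Icc s t, f x ≠ z) :
    logIncr (fun x => f x - y) s t =
      logIncr (fun x => (f x - y) / (f x - z)) s t + logIncr (fun x => f x - z) s t := by
  have h1 : ContinuousOn (fun x => f x - y) (Set.Icc s t) := hf.sub continuousOn_const
  have h2 : ContinuousOn (fun x => f x - z) (Set.Icc s t) := hf.sub continuousOn_const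
  have h3 : ∀ x ∈ Set.Icc s t, f x - z ≠ 0 := fun x hx => sub_ne_zero.2 (hz x hx)
  have h4 : ∀ x ∈ Set.Icc s t, f x - y ≠ 0 := fun x hx => sub_ne_zero.2 (hy x hx)
  rw [← logIncr_mul (f := fun x => (f x - y) / (f x - z)) hst (h1.div h2 h3)
    (fun x hx => div_ne_zero (h4 x hx) (h3 x hx)) h2 h3]
  exact logIncr_congr hst h1 h4 fun x hx => (div_mul_cancel₀ _ (h3 x hx)).symm

theorem halfTurn_eq_of_segment {f : ℝ → ℂ} (hf : Continuous f) {y z : ℂ}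
    (h : ∀ t ∈ Set.Icc (0 : ℝ) 1, f t ∉ segment ℝ y z) :
    halfTurn f y = turnRatio (f 0) (f 1) y z * halfTurn f z := by
  have hy : ∀ x ∈ Set.Icc (0 : ℝ) 1, f x ≠ y :=
    fun x hx e => h x hx (e ▸ left_mem_segment ℝ y z)
  have hz : ∀ x ∈ Set.Icc (0 : ℝ) 1, f x ≠ z :=
    fun x hx e => h x hx (e ▸ right_mem_segment ℝ y z)
  rw [halfTurn, halfTurn, turnRatio, ← Complex.exp_add,
    logIncr_sub_eq zero_le_one hf.continuousOn hy hz,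
    logIncr_of_mem_slitPlane zero_le_one _ fun x hx => div_mem_slitPlane_of_notMem_segment (h x hx)]
  · congr 1
    ring
  · exact ContinuousOn.div (by fun_prop) (by fun_prop) fun x hx => sub_ne_zero.2 (hz x hx)

theorem log_neg_of_im_pos {q : ℂ} (h : 0 < q.im) :
    Complex.log (-q) = Complex.log q - Real.pi * Complex.I := by
  rw [Complex.log, Complex.log, norm_neg, Complex.arg_neg_eq_arg_sub_pi_of_im_pos h]
  push_cast
  ring

theorem log_neg_of_im_neg {q : ℂ} (h : q.im < 0) :
    Complex.log (-q) = Complex.log q + Real.pi * Complex.I := by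
  rw [Complex.log, Complex.log, norm_neg, Complex.arg_neg_eq_arg_add_pi_of_im_neg h]
  push_cast
  ring

theorem im_sub_div_add (p q : ℂ) :
    ((p - q) / (p + q)).im = 2 * (p.im * q.re - p.re * q.im) / Complex.normSq (p + q) := by
  rw [Complex.div_im]
  simp
  ring

/-- When `x` crosses the path `f` transversally at a single affine point, the half-turn picks up
an additional sign. -/
theorem halfTurn_eq_neg_of_crossing {f : ℝ → ℂ} (hf : Continuous f) {t₀ η ε : ℝ} {x₀ v w : ℂ}
    (hη : 0 < η) (h0 : 0 ≤ t₀ - η) (h1 : t₀ + η ≤ 1) (hε : 0 < ε)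
    (hloc : ∀ τ, |τ| ≤ η → f (t₀ + τ) = x₀ + τ * w)
    (hvw : w.im * v.re - w.re * v.im ≠ 0)
    (h : ∀ t ∈ Set.Icc (0 : ℝ) 1, η ≤ |t - t₀| →
      f t ∉ segment ℝ (x₀ + ε * v) (x₀ - ε * v)) :
    halfTurn f (x₀ + ε * v) =
      -(turnRatio (f 0) (f 1) (x₀ + ε * v) (x₀ - ε * v) * halfTurn f (x₀ - ε * v)) := by
  set y := x₀ + ε * v with hy
  set z := x₀ - ε * v with hz
  set q : ℝ → ℂ := fun t => (f t - y) / (f t - z) with hq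
  have hqτ : ∀ τ, |τ| ≤ η → q (t₀ + τ) = (τ * w - ε * v) / (τ * w + ε * v) := by
    intro τ hτ
    simp only [hq, hloc τ hτ, hy, hz]
    congr 1 <;> ring
  have him : ∀ τ, |τ| ≤ η → (q (t₀ + τ)).im =
      2 * τ * ε * (w.im * v.re - w.re * v.im) / Complex.normSq (τ * w + ε * v) := by
    intro τ hτ
    rw [hqτ τ hτ, im_sub_div_add]
    simp
    ring
  have hv : v ≠ 0 := by rintro rfl; simp at hvw
  -- the denominator does not vanish near the crossing, as `v` and `w` are independent
  have hden : ∀ τ : ℝ, (τ * w + ε * v : ℂ) ≠ 0 := by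
    intro τ hτ
    have e1 := congrArg Complex.re hτ
    have e2 := congrArg Complex.im hτ
    simp at e1 e2
    have : ε * (w.im * v.re - w.re * v.im) = 0 := by
      linear_combination w.im * e1 - w.re * e2
    rcases mul_eq_zero.1 this with h | h
    · exact hε.ne' h
    · exact hvw h
  have hslit : ∀ t ∈ Set.Icc (t₀ - η) (t₀ + η), -q t ∈ Complex.slitPlane := by
    intro t ht
    have hτ : |t - t₀| ≤ η := abs_le.2 ⟨by linarith [ht.1], by linarith [ht.2]⟩
    have e : t = t₀ + (t - t₀) := by ring
    rw [Complex.mem_slitPlane_iff]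
    rcases eq_or_ne t t₀ with rfl | hne
    · left
      rw [e, hqτ _ hτ]
      have : (ε : ℂ) ≠ 0 := by exact_mod_cast hε.ne'
      simp [this, hv]
    · right
      rw [e, Complex.neg_im, him _ hτ]
      refine neg_ne_zero.2 (div_ne_zero (mul_ne_zero (mul_ne_zero (mul_ne_zero two_ne_zero
        (sub_ne_zero.2 hne)) hε.ne') hvw) ?_)
      exact fun h => hden _ (Complex.normSq_eq_zero.1 h)
  have hnear : ∀ t ∈ Set.Icc (0 : ℝ) 1, |t - t₀| ≤ η → f t ≠ y ∧ f t ≠ z := by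
    intro t ht hτ
    have hne := Complex.slitPlane_ne_zero
      (hslit t ⟨by linarith [(abs_le.1 hτ).1], by linarith [(abs_le.1 hτ).2]⟩)
    constructor <;> rintro e <;> simp [hq, e] at hne
  have hny : ∀ t ∈ Set.Icc (0 : ℝ) 1, f t ≠ y ∧ f t ≠ z := by
    intro t ht
    rcases le_total |t - t₀| η with hle | hle
    · exact hnear t ht hle
    · exact ⟨fun e => h t ht hle (e ▸ left_mem_segment ℝ y z),
        fun e => h t ht hle (e ▸ right_mem_segment ℝ y z)⟩
  have hqc : ContinuousOn q (Set.Icc 0 1) :=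
    ContinuousOn.div (by fun_prop) (by fun_prop) fun t ht => sub_ne_zero.2 (hny t ht).2
  have hq0 : ∀ t ∈ Set.Icc (0 : ℝ) 1, q t ≠ 0 := fun t ht =>
    div_ne_zero (sub_ne_zero.2 (hny t ht).1) (sub_ne_zero.2 (hny t ht).2)
  have hS1 : Set.Icc 0 (t₀ - η) ⊆ Set.Icc (0 : ℝ) 1 := Set.Icc_subset_Icc le_rfl (by linarith)
  have hS2 : Set.Icc (t₀ - η) 1 ⊆ Set.Icc (0 : ℝ) 1 := Set.Icc_subset_Icc h0 le_rfl
  have hS3 : Set.Icc (t₀ - η) (t₀ + η) ⊆ Set.Icc (0 : ℝ) 1 := Set.Icc_subset_Icc h0 h1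
  have hS4 : Set.Icc (t₀ + η) 1 ⊆ Set.Icc (0 : ℝ) 1 :=
    Set.Icc_subset_Icc (by linarith) le_rfl
  have hm : t₀ - η ≤ t₀ + η := by linarith
  have i1 : logIncr q 0 (t₀ - η) = Complex.log (q (t₀ - η)) - Complex.log (q 0) :=
    logIncr_of_mem_slitPlane h0 (hqc.mono hS1) fun t ht =>
      div_mem_slitPlane_of_notMem_segment
        (h t (hS1 ht) (by rw [abs_of_nonpos (by linarith [ht.2])]; linarith [ht.2]))
  have i2 : logIncr q (t₀ - η) (t₀ + η) =
      Complex.log (-q (t₀ + η)) - Complex.log (-q (t₀ - η)) :=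
    logIncr_of_neg_mem_slitPlane hm (hqc.mono hS3) hslit
  have i3 : logIncr q (t₀ + η) 1 = Complex.log (q 1) - Complex.log (q (t₀ + η)) :=
    logIncr_of_mem_slitPlane h1 (hqc.mono hS4) fun t ht =>
      div_mem_slitPlane_of_notMem_segment
        (h t (hS4 ht) (by rw [abs_of_nonneg (by linarith [ht.1])]; linarith [ht.1]))
  have a1 := logIncr_add h0 (hm.trans h1) hqc hq0
  have a2 := logIncr_add hm h1 (hqc.mono hS2) fun t ht => hq0 t (hS2 ht)
  have imp := him η (abs_of_pos hη).le
  have imm := him (-η) (by rw [abs_neg, abs_of_pos hη])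
  rw [← sub_eq_add_neg] at imm
  have np : 0 < Complex.normSq ((η : ℝ) * w + ε * v) := Complex.normSq_pos.2 (hden η)
  have nm : 0 < Complex.normSq ((-η : ℝ) * w + ε * v) := Complex.normSq_pos.2 (hden (-η))
  -- `q` passes the negative half-axis from one side to the other
  have main : ∃ k : ℂ, Complex.exp (k / 2) = -1 ∧
      logIncr q 0 1 = Complex.log (q 1) - Complex.log (q 0) + k := by
    rw [← a1, ← a2, i1, i2, i3]
    rcases lt_or_gt_of_ne hvw with hneg | hpos
    · have p1 : (q (t₀ + η)).im < 0 := by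
        rw [imp]; exact div_neg_of_neg_of_pos (mul_neg_of_pos_of_neg (by positivity) hneg) np
      have p2 : 0 < (q (t₀ - η)).im := by
        rw [imm]
        exact div_pos (mul_pos_of_neg_of_neg (by nlinarith [mul_pos hη hε]) hneg) nm
      refine ⟨2 * (Real.pi * Complex.I), ?_, ?_⟩
      · rw [mul_div_cancel_left₀ _ two_ne_zero, Complex.exp_pi_mul_I]
      · rw [log_neg_of_im_neg p1, log_neg_of_im_pos p2]
        ring
    · have p1 : 0 < (q (t₀ + η)).im := by
        rw [imp]; exact div_pos (mul_pos (by positivity) hpos) np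
      have p2 : (q (t₀ - η)).im < 0 := by
        rw [imm]
        exact div_neg_of_neg_of_pos
          (mul_neg_of_neg_of_pos (by nlinarith [mul_pos hη hε]) hpos) nm
      refine ⟨2 * -(Real.pi * Complex.I), ?_, ?_⟩
      · rw [mul_div_cancel_left₀ _ two_ne_zero, Complex.exp_neg, Complex.exp_pi_mul_I]
        norm_num
      · rw [log_neg_of_im_pos p1, log_neg_of_im_neg p2]
        ring
  obtain ⟨k, hk, hL⟩ := main
  rw [halfTurn, halfTurn, turnRatio, logIncr_sub_eq zero_le_one hf.continuousOn
    (fun t ht => (hny t ht).1) (fun t ht => (hny t ht).2), hL, ← Complex.exp_add,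
    neg_eq_neg_one_mul, ← hk, ← Complex.exp_add]
  congr 1
  simp only [hq]
  ring

/-! ### Half-turns near the starting point -/

theorem log_one_sub_sub_log_one_sub {z : ℂ} (hz : -z ∈ Complex.slitPlane) {δ : ℝ} (hδ : 0 < δ) :
    Complex.log (1 - z / δ) - Complex.log (1 - δ / z) = Complex.log (-z) - Real.log δ := by
  have hδ' : (δ : ℂ) ≠ 0 := by exact_mod_cast hδ.ne'
  have hz0 : z ≠ 0 := by rintro rfl; simp at hz
  set u : ℂ := -z / δ with hu
  have hu' : u = ((δ⁻¹ : ℝ) : ℂ) * (-z) := by rw [hu]; push_cast; field_simp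
  have hu0 : u ≠ 0 := div_ne_zero (neg_ne_zero.2 hz0) hδ'
  have e1 : 1 - z / δ = u * (1 + u⁻¹) := by rw [mul_add, mul_inv_cancel₀ hu0, hu]; ring
  have e2 : 1 - δ / z = 1 + u⁻¹ := by rw [hu]; field_simp; ring
  have hus : u ∈ Complex.slitPlane := by
    rw [Complex.mem_slitPlane_iff] at hz ⊢
    rw [hu', Complex.re_ofReal_mul, Complex.im_ofReal_mul]
    rcases hz with h | h
    · left; positivity
    · right; positivity
  have hn : 0 < Complex.normSq u := Complex.normSq_pos.2 hu0
  -- `u` and `1 + u⁻¹` lie in opposite half-planes, so that their arguments add up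
  have key : u.arg + (1 + u⁻¹).arg ∈ Set.Ioc (-Real.pi) Real.pi ∧ 1 + u⁻¹ ≠ 0 := by
    have him : (1 + u⁻¹).im = -(u.im / Complex.normSq u) := by
      simp [Complex.inv_im, neg_div]
    have hpi := Real.pi_pos
    rcases lt_trichotomy u.im 0 with h | h | h
    · have h2 : 0 < (1 + u⁻¹).im := by
        rw [him]; exact neg_pos.2 (div_neg_of_neg_of_pos h hn)
      have := Complex.neg_pi_lt_arg u
      have := Complex.arg_le_pi (1 + u⁻¹)
      have := Complex.arg_neg_iff.2 h
      have := Complex.arg_nonneg_iff.2 h2.le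
      exact ⟨⟨by linarith, by linarith⟩, fun e => by simp [e] at h2⟩
    · have hre : 0 < u.re := by
        rcases Complex.mem_slitPlane_iff.1 hus with h' | h'
        · exact h'
        · exact absurd h h'
      have hr2 : 0 < (1 + u⁻¹).re := by
        simp only [Complex.add_re, Complex.one_re, Complex.inv_re]
        positivity
      have a1 : u.arg = 0 := Complex.arg_eq_zero_iff.2 ⟨hre.le, h⟩
      have a2 : (1 + u⁻¹).arg = 0 := Complex.arg_eq_zero_iff.2 ⟨hr2.le, by rw [him, h]; simp⟩
      rw [a1, a2]
      exact ⟨⟨by linarith, by linarith⟩, fun e => by simp [e] at hr2⟩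
    · have h2 : (1 + u⁻¹).im < 0 := by
        rw [him]; exact neg_neg_of_pos (div_pos h hn)
      have := Complex.neg_pi_lt_arg (1 + u⁻¹)
      have := Complex.arg_le_pi u
      have := Complex.arg_neg_iff.2 h2
      have := Complex.arg_nonneg_iff.2 h.le
      exact ⟨⟨by linarith, by linarith⟩, fun e => by simp [e] at h2⟩
  rw [e1, e2, Complex.log_mul hu0 key.2 key.1, hu',
    Complex.log_ofReal_mul (inv_pos.2 hδ) (neg_ne_zero.2 hz0), Real.log_inv]
  push_cast
  ring

theorem one_sub_mul_mem_slitPlane {z : ℂ} (hz : -z ∈ Complex.slitPlane) {r : ℝ} (hr : 0 ≤ r) :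
    1 - r * z ∈ Complex.slitPlane := by
  rw [Complex.mem_slitPlane_iff] at hz ⊢
  rcases hr.eq_or_lt with rfl | hr
  · simp
  · simp only [Complex.sub_re, Complex.sub_im, Complex.one_re, Complex.one_im,
      Complex.re_ofReal_mul, Complex.im_ofReal_mul]
    rcases hz with h | h
    · left
      rw [Complex.neg_re] at h
      nlinarith
    · right
      rw [Complex.neg_im] at h
      have : z.im ≠ 0 := fun e => h (by rw [e, neg_zero])
      rw [zero_sub]
      exact neg_ne_zero.2 (mul_ne_zero hr.ne' this)

theorem notMem_segment_of_norm_lt {p y z x : ℂ} {ρ : ℝ} (hy : ‖y - x‖ < ρ) (hz : ‖z - x‖ < ρ)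
    (hp : ρ ≤ ‖p - x‖) : p ∉ segment ℝ y z := by
  intro h
  have := (convex_ball x ρ).segment_subset (mem_ball_iff_norm.2 hy) (mem_ball_iff_norm.2 hz) h
  exact absurd (mem_ball_iff_norm.1 this) (not_lt.2 hp)

/-- A path that misses a point over a compact interval keeps a positive distance from it. -/
theorem exists_le_norm_sub {f : ℝ → ℂ} {K : Set ℝ} (hK : IsCompact K) (hf : Continuous f) {x : ℂ}
    (h : ∀ t ∈ K, f t ≠ x) : ∃ ρ > (0 : ℝ), ∀ t ∈ K, ρ ≤ ‖f t - x‖ := by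
  rcases K.eq_empty_or_nonempty with rfl | hne
  · exact ⟨1, one_pos, by simp⟩
  obtain ⟨t, ht, hmin⟩ := hK.exists_isMinOn hne
    (f := fun t => ‖f t - x‖) (by fun_prop)
  exact ⟨‖f t - x‖, norm_pos_iff.2 (sub_ne_zero.2 (h t ht)), fun u hu => hmin hu⟩

/-- The factor of `halfTurn f (A + s u)` that does not depend on the path `f` from `A` to `B`. -/
noncomputable def startFactor (A B : ℂ) (s t₁ : ℝ) (u : ℂ) : ℂ :=
  Complex.exp ((Complex.log ((B - (A + s * u)) / (B - A)) - Real.log (s / t₁)) / 2)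

/-- The half-turn, about a point close to the start `A` of a path, as a product of a factor
depending on the path only, a factor depending on the point only, and a principal square root of
the negative quotient of the initial direction of the path and the direction of the point. -/
theorem halfTurn_near_start {f : ℝ → ℂ} (hf : Continuous f) {A u v : ℂ} {t₁ : ℝ} (ht₁ : 0 < t₁)
    (ht₁' : t₁ ≤ 1) (hloc : ∀ t ∈ Set.Icc 0 t₁, f t = A + t * v)
    (hA : ∀ t ∈ Set.Icc t₁ 1, f t ≠ A) (huv : -(v / u) ∈ Complex.slitPlane) :
    ∃ s₀ > (0 : ℝ), ∀ s ∈ Set.Ioo 0 s₀, halfTurn f (A + s * u) =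
      Complex.exp (logIncr (fun t => f t - A) t₁ 1 / 2) * startFactor A (f 1) s t₁ u *
        Complex.exp (Complex.log (-(v / u)) / 2) := by
  have hu : u ≠ 0 := by rintro rfl; simp at huv
  have hv : v ≠ 0 := by rintro rfl; simp at huv
  have hun : 0 < ‖u‖ := norm_pos_iff.2 hu
  obtain ⟨ρ, hρ, hρf⟩ := exists_le_norm_sub isCompact_Icc hf hA
  refine ⟨ρ / ‖u‖, by positivity, fun s hs => ?_⟩
  have hs0 : 0 < s := hs.1
  have hs0' : (s : ℂ) ≠ 0 := by exact_mod_cast hs0.ne'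
  have ht0' : (t₁ : ℂ) ≠ 0 := by exact_mod_cast ht₁.ne'
  have hsu : ‖(A + s * u) - A‖ < ρ := by
    rw [add_sub_cancel_left, norm_mul, Complex.norm_real, Real.norm_of_nonneg hs0.le]
    exact (lt_div_iff₀ hun).1 hs.2
  set y := A + s * u with hy
  have hseg : ∀ t ∈ Set.Icc t₁ 1, f t ∉ segment ℝ y A := fun t ht =>
    notMem_segment_of_norm_lt hsu (by simpa using hρ) (hρf t ht)
  have hfac : ∀ t ∈ Set.Icc 0 t₁, f t - y = (-(s * u)) * (1 - (t / s : ℝ) * (v / u)) := by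
    intro t ht
    rw [hloc t ht, hy]
    push_cast
    field_simp
    ring
  have hsl : ∀ t ∈ Set.Icc 0 t₁, 1 - ((t / s : ℝ) : ℂ) * (v / u) ∈ Complex.slitPlane :=
    fun t ht => one_sub_mul_mem_slitPlane huv (div_nonneg ht.1 hs0.le)
  have hc : -((s : ℂ) * u) ≠ 0 := neg_ne_zero.2 (mul_ne_zero hs0' hu)
  have hny : ∀ t ∈ Set.Icc (0 : ℝ) 1, f t ≠ y := by
    intro t ht
    rcases le_total t t₁ with h | h
    · rw [← sub_ne_zero, hfac t ⟨ht.1, h⟩]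
      exact mul_ne_zero hc (Complex.slitPlane_ne_zero (hsl t ⟨ht.1, h⟩))
    · exact fun e => hseg t ⟨h, ht.2⟩ (e ▸ left_mem_segment ℝ y A)
  have hcont : ContinuousOn (fun t => f t - y) (Set.Icc 0 1) := by fun_prop
  have hsub1 : Set.Icc 0 t₁ ⊆ Set.Icc (0 : ℝ) 1 := Set.Icc_subset_Icc le_rfl ht₁'
  have hsub2 : Set.Icc t₁ 1 ⊆ Set.Icc (0 : ℝ) 1 := Set.Icc_subset_Icc ht₁.le le_rfl
  have i1 : logIncr (fun t => f t - y) 0 t₁ =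
      Complex.log (1 - (v / u) / (s / t₁ : ℝ)) := by
    rw [logIncr_congr ht₁.le (hcont.mono hsub1)
      (fun t ht => sub_ne_zero.2 (hny t (hsub1 ht))) hfac,
      logIncr_mul ht₁.le continuousOn_const (fun _ _ => hc) (by fun_prop)
        (fun t ht => Complex.slitPlane_ne_zero (hsl t ht)),
      logIncr_const hc ht₁.le, logIncr_of_mem_slitPlane ht₁.le (by fun_prop) hsl]
    simp only [zero_div, Complex.ofReal_zero, zero_mul, sub_zero, Complex.log_one, zero_add]
    congr 2
    push_cast
    field_simp
  have i2 : logIncr (fun t => f t - y) t₁ 1 =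
      Complex.log ((f 1 - y) / (f 1 - A)) - Complex.log (1 - (s / t₁ : ℝ) / (v / u)) +
        logIncr (fun t => f t - A) t₁ 1 := by
    rw [logIncr_sub_eq ht₁' hf.continuousOn (fun t ht => hny t (hsub2 ht)) hA,
      logIncr_of_mem_slitPlane (f := fun t => (f t - y) / (f t - A)) ht₁'
        (ContinuousOn.div (by fun_prop) (by fun_prop) fun t ht => sub_ne_zero.2 (hA t ht))
        fun t ht => div_mem_slitPlane_of_notMem_segment (hseg t ht),
      hloc t₁ (Set.right_mem_Icc.2 ht₁.le)]
    congr 3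
    rw [hy]
    push_cast
    field_simp
    ring
  have key := log_one_sub_sub_log_one_sub huv (div_pos hs0 ht₁)
  rw [halfTurn, ← logIncr_add ht₁.le ht₁' hcont (fun t ht => sub_ne_zero.2 (hny t ht)), i1, i2,
    startFactor, ← Complex.exp_add, ← Complex.exp_add, ← hy]
  congr 1
  linear_combination key / 2

/-- For three paths leaving `A` in three different directions, the three half-turns about a point
of each path close to `A`, along the loop formed by the other two, multiply up to `-1`. -/
theorem prod_halfTurn_near_start {f g h : ℝ → ℂ} (hf : Continuous f) (hg : Continuous g)
    (hh : Continuous h) {A B u v w : ℂ} (hfB : f 1 = B) (hgB : g 1 = B) (hhB : h 1 = B)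
    {t₁ : ℝ} (ht₁ : 0 < t₁) (ht₁' : t₁ ≤ 1)
    (hfl : ∀ t ∈ Set.Icc 0 t₁, f t = A + t * u) (hgl : ∀ t ∈ Set.Icc 0 t₁, g t = A + t * v)
    (hhl : ∀ t ∈ Set.Icc 0 t₁, h t = A + t * w)
    (hfA : ∀ t ∈ Set.Icc t₁ 1, f t ≠ A) (hgA : ∀ t ∈ Set.Icc t₁ 1, g t ≠ A)
    (hhA : ∀ t ∈ Set.Icc t₁ 1, h t ≠ A)
    (huv : -(u / v) ∈ Complex.slitPlane) (hvw : -(v / w) ∈ Complex.slitPlane)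
    (hwu : -(w / u) ∈ Complex.slitPlane) :
    ∃ s₀ > (0 : ℝ), ∀ s ∈ Set.Ioo 0 s₀,
      (halfTurn h (f s) / halfTurn g (f s)) * (halfTurn f (g s) / halfTurn h (g s)) *
        (halfTurn g (h s) / halfTurn f (h s)) = -1 := by
  have hinv : ∀ {x y : ℂ}, -(x / y) ∈ Complex.slitPlane → -(y / x) ∈ Complex.slitPlane ∧
      Complex.exp (Complex.log (-(y / x)) / 2) =
        (Complex.exp (Complex.log (-(x / y)) / 2))⁻¹ ∧
      Complex.exp (Complex.log (-(x / y)) / 2) ^ 2 = -(x / y) := by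
    intro x y hxy
    have e : -(y / x) = (-(x / y))⁻¹ := by rw [inv_neg, inv_div]
    have ha := Complex.mem_slitPlane_iff_arg.1 hxy
    refine ⟨?_, ?_, ?_⟩
    · rw [e, Complex.mem_slitPlane_iff_arg, Complex.arg_inv, if_neg ha.1]
      refine ⟨fun h => ?_, inv_ne_zero ha.2⟩
      have := Complex.neg_pi_lt_arg (-(x / y))
      linarith
    · rw [e, Complex.log_inv _ ha.1, neg_div, Complex.exp_neg]
    · rw [← Complex.exp_nat_mul]
      push_cast
      rw [mul_div_cancel₀ _ two_ne_zero, Complex.exp_log ha.2]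
  obtain ⟨hvu, euv, quv⟩ := hinv huv
  obtain ⟨hwv, evw, qvw⟩ := hinv hvw
  obtain ⟨huw, ewu, qwu⟩ := hinv hwu
  have hu : u ≠ 0 := by rintro rfl; simp at huv
  have hv : v ≠ 0 := by rintro rfl; simp at huv
  have hw : w ≠ 0 := by rintro rfl; simp at hvw
  obtain ⟨s1, p1, k1⟩ := halfTurn_near_start hh ht₁ ht₁' hhl hhA hwu
  obtain ⟨s2, p2, k2⟩ := halfTurn_near_start hg ht₁ ht₁' hgl hgA hvu
  obtain ⟨s3, p3, k3⟩ := halfTurn_near_start hf ht₁ ht₁' hfl hfA huv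
  obtain ⟨s4, p4, k4⟩ := halfTurn_near_start hh ht₁ ht₁' hhl hhA hwv
  obtain ⟨s5, p5, k5⟩ := halfTurn_near_start hg ht₁ ht₁' hgl hgA hvw
  obtain ⟨s6, p6, k6⟩ := halfTurn_near_start hf ht₁ ht₁' hfl hfA huw
  refine ⟨min t₁ (min (min s1 (min s2 s3)) (min s4 (min s5 s6))), by simp [*], fun s hs => ?_⟩
  obtain ⟨hs0, hs⟩ := hs
  simp only [lt_min_iff] at hs
  obtain ⟨ht, ⟨l1, l2, l3⟩, l4, l5, l6⟩ := hs
  rw [hfl s ⟨hs0.le, ht.le⟩, hgl s ⟨hs0.le, ht.le⟩, hhl s ⟨hs0.le, ht.le⟩,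
    k1 s ⟨hs0, l1⟩, k2 s ⟨hs0, l2⟩, k3 s ⟨hs0, l3⟩, k4 s ⟨hs0, l4⟩, k5 s ⟨hs0, l5⟩,
    k6 s ⟨hs0, l6⟩, hfB, hgB, hhB, euv, evw, ewu]
  set a := Complex.exp (Complex.log (-(u / v)) / 2) with ha
  set b := Complex.exp (Complex.log (-(v / w)) / 2) with hb
  set c := Complex.exp (Complex.log (-(w / u)) / 2) with hc
  have na : a ≠ 0 := Complex.exp_ne_zero _
  have nb : b ≠ 0 := Complex.exp_ne_zero _
  have nc : c ≠ 0 := Complex.exp_ne_zero _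
  have habc : a ^ 2 * b ^ 2 * c ^ 2 = -1 := by
    rw [quv, qvw, qwu]
    field_simp
  have nF : ∀ z, startFactor A B s t₁ z ≠ 0 := fun z => Complex.exp_ne_zero _
  have n1 := nF u
  have n2 := nF v
  have n3 := nF w
  have nE : ∀ z, Complex.exp z ≠ 0 := Complex.exp_ne_zero
  rw [← habc]
  field_simp

/-! ### The sign of a point with respect to a pair of paths -/

/-- For two paths `f` and `g` with the same endpoints, the number `(-1) ^ k`, where `k` is the
winding number about `x` of the loop formed by `f` and `g`. -/
noncomputable def turnSign (f g : ℝ → ℂ) (x : ℂ) : ℂ := halfTurn g x / halfTurn f x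

theorem turnSign_inv (f g : ℝ → ℂ) (x : ℂ) : (turnSign f g x)⁻¹ = turnSign g f x := inv_div _ _

theorem turnRatio_ne_zero (A B y z : ℂ) : turnRatio A B y z ≠ 0 := Complex.exp_ne_zero _

theorem turnSign_eq_one_or {f g : ℝ → ℂ} (hf : Continuous f) (hg : Continuous g)
    (h0 : f 0 = g 0) (h1 : f 1 = g 1) {x : ℂ} (hfx : ∀ t ∈ Set.Icc (0 : ℝ) 1, f t ≠ x)
    (hgx : ∀ t ∈ Set.Icc (0 : ℝ) 1, g t ≠ x) : turnSign f g x = 1 ∨ turnSign f g x = -1 := by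
  rw [← sq_eq_one_iff, turnSign, div_pow, halfTurn_sq hf hfx, halfTurn_sq hg hgx, h0, h1]
  refine div_self (div_ne_zero (sub_ne_zero.2 (hgx 1 (by simp))) (sub_ne_zero.2 (hgx 0 (by simp))))

theorem turnSign_eventually_eq {f g : ℝ → ℂ} (hf : Continuous f) (hg : Continuous g)
    (h0 : f 0 = g 0) (h1 : f 1 = g 1) {x : ℂ} (hfx : ∀ t ∈ Set.Icc (0 : ℝ) 1, f t ≠ x)
    (hgx : ∀ t ∈ Set.Icc (0 : ℝ) 1, g t ≠ x) :
    ∀ᶠ y in nhds x, turnSign f g y = turnSign f g x := by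
  obtain ⟨ρ, hρ, hρf⟩ := exists_le_norm_sub isCompact_Icc hf hfx
  obtain ⟨σ, hσ, hσg⟩ := exists_le_norm_sub isCompact_Icc hg hgx
  filter_upwards [Metric.ball_mem_nhds x hρ, Metric.ball_mem_nhds x hσ] with y hy hy'
  rw [mem_ball_iff_norm] at hy hy'
  rw [turnSign, turnSign,
    halfTurn_eq_of_segment hf fun t ht =>
      notMem_segment_of_norm_lt (z := x) hy (by simpa using hρ) (hρf t ht),
    halfTurn_eq_of_segment hg fun t ht =>
      notMem_segment_of_norm_lt (z := x) hy' (by simpa using hσ) (hσg t ht), h0, h1]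
  exact mul_div_mul_left _ _ (turnRatio_ne_zero _ _ _ _)

/-- The sign of a pair of paths `f`, `g` changes when the point crosses `f` transversally. -/
theorem turnSign_crossing {f g : ℝ → ℂ} (hf : Continuous f) (hg : Continuous g)
    (h0 : f 0 = g 0) (h1 : f 1 = g 1) {t₀ η : ℝ} {x₀ v w : ℂ}
    (hη : 0 < η) (hη0 : 0 ≤ t₀ - η) (hη1 : t₀ + η ≤ 1)
    (hloc : ∀ τ, |τ| ≤ η → f (t₀ + τ) = x₀ + τ * w)
    (hvw : w.im * v.re - w.re * v.im ≠ 0)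
    (hfx : ∀ t ∈ Set.Icc (0 : ℝ) 1, f t = x₀ → t = t₀)
    (hgx : ∀ t ∈ Set.Icc (0 : ℝ) 1, g t ≠ x₀) :
    ∃ ε₀ > (0 : ℝ), ∀ ε ∈ Set.Ioo 0 ε₀,
      turnSign f g (x₀ + ε * v) = -turnSign f g (x₀ - ε * v) := by
  have hv : v ≠ 0 := by rintro rfl; simp at hvw
  have hvn : 0 < ‖v‖ := norm_pos_iff.2 hv
  obtain ⟨σ, hσ, hσg⟩ := exists_le_norm_sub isCompact_Icc hg hgx
  have hK : IsCompact (Set.Icc (0 : ℝ) 1 ∩ {t | η ≤ |t - t₀|}) :=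
    isCompact_Icc.inter_right (isClosed_le continuous_const (by fun_prop))
  obtain ⟨ρ, hρ, hρf⟩ := exists_le_norm_sub (x := x₀) hK hf (by
    rintro t ⟨ht, ht'⟩ e
    have := hfx t ht e
    subst this
    simp at ht'
    exact absurd ht' (not_le.2 hη))
  refine ⟨min ρ σ / ‖v‖, by positivity, fun ε hε => ?_⟩
  have hn : ε * ‖v‖ < min ρ σ := (lt_div_iff₀ hvn).1 hε.2
  obtain ⟨n1, n2⟩ := lt_min_iff.1 hn
  have hεn : ‖(ε : ℂ) * v‖ = ε * ‖v‖ := by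
    rw [norm_mul, Complex.norm_real, Real.norm_of_nonneg hε.1.le]
  have e1 : ‖x₀ + ε * v - x₀‖ = ε * ‖v‖ := by rw [add_sub_cancel_left, hεn]
  have e2 : ‖x₀ - ε * v - x₀‖ = ε * ‖v‖ := by rw [sub_sub_cancel_left, norm_neg, hεn]
  rw [turnSign, turnSign,
    halfTurn_eq_neg_of_crossing hf hη hη0 hη1 hε.1 hloc hvw fun t ht ht' =>
      notMem_segment_of_norm_lt (by rwa [e1]) (by rwa [e2]) (hρf t ⟨ht, ht'⟩),
    halfTurn_eq_of_segment hg fun t ht =>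
      notMem_segment_of_norm_lt (by rwa [e1]) (by rwa [e2]) (hσg t ht), h0, h1, div_neg]
  rw [mul_div_mul_left _ _ (turnRatio_ne_zero _ _ _ _)]

/-! ### Local structure of piecewise linear paths in general position -/

theorem IsPLPath.exists_affine_right {A B : ℂ} {γ : Path A B} (h : IsPLPath γ) {s : ℝ}
    (hs : s ∈ Set.Ico (0 : ℝ) 1) :
    ∃ δ > (0 : ℝ), s + δ ≤ 1 ∧
      ∃ v : ℂ, ∀ τ ∈ Set.Icc 0 δ, γ.extend (s + τ) = γ.extend s + τ * v := by
  obtain ⟨n, τ, hτ, h0, h1, haff⟩ := h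
  obtain ⟨j, hj, hmax⟩ := Finset.exists_max_image (Finset.univ.filter fun j => τ j ≤ s) id
    ⟨0, by simpa [h0] using hs.1⟩
  simp only [Finset.mem_filter, Finset.mem_univ, true_and, id] at hj hmax
  have hjl : j ≠ Fin.last n := by
    rintro rfl
    exact absurd hj (by rw [h1]; exact not_le.2 hs.2)
  obtain ⟨i, rfl⟩ := Fin.exists_castSucc_eq.2 hjl
  have hi : s < τ i.succ := by
    by_contra hc
    exact absurd (hmax _ (not_lt.1 hc)) (not_le.2 (Fin.castSucc_lt_succ))
  have hle1 : τ i.succ ≤ 1 := h1 ▸ hτ.monotone (Fin.le_last _)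
  obtain ⟨u, v, huv⟩ := haff i
  have key : ∀ t, s ≤ t → t ≤ τ i.succ → γ.extend t = u + t * v := by
    intro t ht ht'
    have hm : t ∈ Set.Icc (0 : ℝ) 1 := ⟨hs.1.trans ht, ht'.trans hle1⟩
    rw [Path.extend_apply _ hm, huv ⟨t, hm⟩ (hj.trans ht) ht', Complex.real_smul]
  refine ⟨τ i.succ - s, by linarith, by linarith, v, fun r hr => ?_⟩
  rw [key (s + r) (by linarith [hr.1]) (by linarith [hr.2]), key s le_rfl hi.le]
  push_cast
  ring

theorem IsPLPath.symm {A B : ℂ} {γ : Path A B} (h : IsPLPath γ) : IsPLPath γ.symm := by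
  obtain ⟨n, τ, hτ, h0, h1, haff⟩ := h
  refine ⟨n, fun j => 1 - τ j.rev, ?_, ?_, ?_, fun i => ?_⟩
  · intro j k hjk
    exact sub_lt_sub_left (hτ (Fin.rev_lt_rev.2 hjk)) 1
  · simp [Fin.rev_zero, h1]
  · simp [Fin.rev_last, h0]
  · obtain ⟨u, v, huv⟩ := haff i.rev
    refine ⟨u + v, -v, fun t ht ht' => ?_⟩
    simp only [Fin.rev_castSucc] at ht
    simp only [Fin.rev_succ] at ht'
    have := huv (unitInterval.symm t) (by rw [unitInterval.coe_symm_eq]; linarith)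
      (by rw [unitInterval.coe_symm_eq]; linarith)
    rw [Path.symm_apply, Function.comp_apply, this, unitInterval.coe_symm_eq, sub_smul, one_smul,
      smul_neg]
    ring

theorem IsPLPath.exists_affine_left {A B : ℂ} {γ : Path A B} (h : IsPLPath γ) {s : ℝ}
    (hs : s ∈ Set.Ioc (0 : ℝ) 1) :
    ∃ δ > (0 : ℝ), 0 ≤ s - δ ∧
      ∃ v : ℂ, ∀ τ ∈ Set.Icc 0 δ, γ.extend (s - τ) = γ.extend s + τ * v := by
  obtain ⟨δ, hδ, hδ1, v, hv⟩ := h.symm.exists_affine_right (s := 1 - s)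
    ⟨by linarith [hs.2], by linarith [hs.1]⟩
  refine ⟨δ, hδ, by linarith, v, fun τ hτ => ?_⟩
  have := hv τ hτ
  rw [Path.extend_symm_apply, Path.extend_symm_apply] at this
  rw [← show 1 - (1 - s) = s by ring, ← this]
  congr 1
  ring

/-- A piecewise linear path is affine near every time at which it has a velocity. -/
theorem IsPLPath.exists_affine_of_hasDerivAt {A B : ℂ} {γ : Path A B} (h : IsPLPath γ) {s : ℝ}
    (hs : s ∈ Set.Ioo (0 : ℝ) 1) {v : ℂ} (hv : HasDerivAt γ.extend v s) :
    ∃ δ > (0 : ℝ), 0 ≤ s - δ ∧ s + δ ≤ 1 ∧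
      ∀ τ, |τ| ≤ δ → γ.extend (s + τ) = γ.extend s + τ * v := by
  obtain ⟨δ, hδ, hδ1, u, hu⟩ := h.exists_affine_right ⟨hs.1.le, hs.2⟩
  obtain ⟨δ', hδ', hδ1', u', hu'⟩ := h.exists_affine_left ⟨hs.1, hs.2.le⟩
  have aff : ∀ (w : ℂ) (S : Set ℝ),
      HasDerivWithinAt (fun t : ℝ => γ.extend s + ((t - s : ℝ) : ℂ) * w) w S s := by
    intro w S
    have h1 : HasDerivAt (fun t : ℝ => ((t - s : ℝ) : ℂ)) 1 s := by
      simpa using ((hasDerivAt_id s).sub_const s).ofReal_comp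
    have h2 := (h1.mul_const w).const_add (γ.extend s)
    rw [one_mul] at h2
    exact h2.hasDerivWithinAt
  have e1 : u = v := by
    refine (uniqueDiffWithinAt_Ici s).eq_deriv _ ?_ hv.hasDerivWithinAt
    refine (aff u (Set.Ici s)).congr_of_eventuallyEq ?_ (by simp)
    filter_upwards [Icc_mem_nhdsGE (show s < s + δ by linarith)] with t ht
    rw [← hu (t - s) ⟨by linarith [ht.1], by linarith [ht.2]⟩]
    congr 1
    ring
  have e2 : -u' = v := by
    refine (uniqueDiffWithinAt_Iic s).eq_deriv _ ?_ hv.hasDerivWithinAt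
    refine (aff (-u') (Set.Iic s)).congr_of_eventuallyEq ?_ (by simp)
    filter_upwards [Icc_mem_nhdsLE (show s - δ' < s by linarith)] with t ht
    have := hu' (s - t) ⟨by linarith [ht.2], by linarith [ht.1]⟩
    rw [sub_sub_cancel] at this
    rw [this]
    push_cast
    ring
  refine ⟨min δ δ', lt_min hδ hδ', by linarith [min_le_right δ δ'], by linarith [min_le_left δ δ'],
    fun τ hτ => ?_⟩
  rcases le_total 0 τ with h0 | h0
  · rw [abs_of_nonneg h0] at hτ
    rw [hu τ ⟨h0, hτ.trans (min_le_left _ _)⟩, e1]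
  · rw [abs_of_nonpos h0] at hτ
    have := hu' (-τ) ⟨by linarith, hτ.trans (min_le_right _ _)⟩
    rw [sub_neg_eq_add] at this
    rw [this, ← e2]
    push_cast
    ring

theorem LinearIndependent.det_ne_zero_of_pair {v w : ℂ} (h : LinearIndependent ℝ ![v, w]) :
    w.im * v.re - w.re * v.im ≠ 0 := by
  intro hd
  rw [LinearIndependent.pair_iff] at h
  have h1 := h w.re (-v.re) (by apply Complex.ext <;> simp <;> linarith)
  have h2 := h w.im (-v.im) (by apply Complex.ext <;> simp <;> linarith)
  have hv : v = 0 := Complex.ext (by simpa using h1.2) (by simpa using h2.2)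
  have := h 1 0 (by simp [hv])
  simp at this

section GeneralPosition

variable {ι : Type*} {A B : ℂ} {p : ι → Path A B}

theorem InGeneralPosition.eq_zero_of_extend_eq (h : InGeneralPosition p) {i : ι} {t : ℝ}
    (ht : t ∈ Set.Icc (0 : ℝ) 1) (e : (p i).extend t = A) : t = 0 := by
  rw [Path.extend_apply _ ht] at e
  exact congrArg Subtype.val (h.start_only i _ e)

theorem InGeneralPosition.eq_one_of_extend_eq (h : InGeneralPosition p) {i : ι} {t : ℝ}
    (ht : t ∈ Set.Icc (0 : ℝ) 1) (e : (p i).extend t = B) : t = 1 := by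
  rw [Path.extend_apply _ ht] at e
  exact congrArg Subtype.val (h.end_only i _ e)

theorem InGeneralPosition.exists_deriv (h : InGeneralPosition p) {i j : ι} {s t : ℝ}
    (hs : s ∈ Set.Ioo (0 : ℝ) 1) (ht : t ∈ Set.Ioo (0 : ℝ) 1) (hne : (i, s) ≠ (j, t))
    (e : (p i).extend s = (p j).extend t) :
    ∃ v w : ℂ, HasDerivAt (p i).extend v s ∧ HasDerivAt (p j).extend w t ∧
      LinearIndependent ℝ ![v, w] := by
  have hs' : s ∈ Set.Icc (0 : ℝ) 1 := ⟨hs.1.le, hs.2.le⟩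
  have ht' : t ∈ Set.Icc (0 : ℝ) 1 := ⟨ht.1.le, ht.2.le⟩
  rw [Path.extend_apply _ hs', Path.extend_apply _ ht'] at e
  refine h.transverse i j ⟨s, hs'⟩ ⟨t, ht'⟩ hs ht (fun e' => hne ?_) e
  simpa using e'

theorem InGeneralPosition.no_triple_extend (h : InGeneralPosition p) {i j k : ι} {s t u : ℝ}
    (hs : s ∈ Set.Ioo (0 : ℝ) 1) (ht : t ∈ Set.Ioo (0 : ℝ) 1) (hu : u ∈ Set.Ioo (0 : ℝ) 1)
    (h1 : (i, s) ≠ (j, t)) (h2 : (j, t) ≠ (k, u)) (h3 : (i, s) ≠ (k, u))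
    (e1 : (p i).extend s = (p j).extend t) (e2 : (p j).extend t = (p k).extend u) : False := by
  have hs' : s ∈ Set.Icc (0 : ℝ) 1 := ⟨hs.1.le, hs.2.le⟩
  have ht' : t ∈ Set.Icc (0 : ℝ) 1 := ⟨ht.1.le, ht.2.le⟩
  have hu' : u ∈ Set.Icc (0 : ℝ) 1 := ⟨hu.1.le, hu.2.le⟩
  rw [Path.extend_apply _ hs', Path.extend_apply _ ht'] at e1
  rw [Path.extend_apply _ ht', Path.extend_apply _ hu'] at e2
  refine h.no_triple i j k ⟨s, hs'⟩ ⟨t, ht'⟩ ⟨u, hu'⟩ hs ht hu (fun e => h1 ?_) (fun e => h2 ?_)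
    (fun e => h3 ?_) ⟨e1, e2⟩ <;> simpa using e

/-- A path that meets an inner point of another path is not at one of its endpoints there. -/
theorem InGeneralPosition.mem_Ioo_of_extend_eq (h : InGeneralPosition p) {i j : ι} {s t : ℝ}
    (hs : s ∈ Set.Ioo (0 : ℝ) 1) (ht : t ∈ Set.Icc (0 : ℝ) 1)
    (e : (p i).extend s = (p j).extend t) : t ∈ Set.Ioo (0 : ℝ) 1 := by
  refine ⟨ht.1.lt_of_ne ?_, ht.2.lt_of_ne ?_⟩
  · rintro rfl
    rw [Path.extend_zero] at e
    exact hs.1.ne' (h.eq_zero_of_extend_eq ⟨hs.1.le, hs.2.le⟩ e)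
  · rintro rfl
    rw [Path.extend_one] at e
    exact hs.2.ne (h.eq_one_of_extend_eq ⟨hs.1.le, hs.2.le⟩ e)

/-- Two different paths leave a common endpoint in different directions. Here `e` is the time of
the endpoint, and `κ = ± 1` is the direction of time leading away from it. -/
theorem InGeneralPosition.neg_div_mem_slitPlane (h : InGeneralPosition p) {i j : ι} (hij : i ≠ j)
    {e κ δ : ℝ} {x₀ v w : ℂ} (hκ : κ * κ = 1) (hδ : 0 < δ)
    (he : ∀ τ ∈ Set.Ioo 0 δ, e + κ * τ ∈ Set.Ioo (0 : ℝ) 1)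
    (hi : ∀ τ ∈ Set.Icc 0 δ, (p i).extend (e + κ * τ) = x₀ + τ * v)
    (hj : ∀ τ ∈ Set.Icc 0 δ, (p j).extend (e + κ * τ) = x₀ + τ * w)
    (hv : v ≠ 0) (hw : w ≠ 0) : -(v / w) ∈ Complex.slitPlane := by
  by_contra hs
  rw [Complex.mem_slitPlane_iff] at hs
  push Not at hs
  obtain ⟨hre, him⟩ := hs
  rw [Complex.neg_re, neg_nonpos] at hre
  rw [Complex.neg_im, neg_eq_zero] at him
  set r := (v / w).re with hr
  have hvr : v = r * w := by
    rw [← div_eq_iff hw]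
    exact Complex.ext (by simp [hr]) (by simpa using him)
  have hr0 : 0 < r := hre.lt_of_ne (by
    intro h0
    rw [← h0] at hvr
    exact hv (by simpa using hvr))
  have deriv : ∀ (k : ι) (z : ℂ), (∀ τ ∈ Set.Icc 0 δ, (p k).extend (e + κ * τ) = x₀ + τ * z) →
      ∀ τ ∈ Set.Ioo 0 δ, HasDerivAt (p k).extend (κ * z) (e + κ * τ) := by
    intro k z hk τ hτ
    have h1 : HasDerivAt (fun t : ℝ => ((κ * (t - e) : ℝ) : ℂ)) κ (e + κ * τ) := by
      simpa using (((hasDerivAt_id (e + κ * τ)).sub_const e).const_mul κ).ofReal_comp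
    refine ((h1.mul_const z).const_add x₀).congr_of_eventuallyEq ?_
    have hc : Filter.Tendsto (fun t : ℝ => κ * (t - e)) (nhds (e + κ * τ)) (nhds τ) := by
      have : Continuous fun t : ℝ => κ * (t - e) := by fun_prop
      convert this.tendsto (e + κ * τ) using 2
      linear_combination -τ * hκ
    filter_upwards [hc (Icc_mem_nhds hτ.1 hτ.2)] with t ht
    rw [← hk _ ht]
    congr 1
    linear_combination -(t - e) * hκ
  have ht1 : δ / (1 + r) ∈ Set.Ioo 0 δ :=
    ⟨by positivity, (div_lt_iff₀ (by positivity)).2 (by nlinarith)⟩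
  have ht2 : r * (δ / (1 + r)) ∈ Set.Ioo 0 δ := by
    refine ⟨by positivity, ?_⟩
    rw [← mul_div_assoc, div_lt_iff₀ (by positivity)]
    nlinarith
  obtain ⟨v', w', hv', hw', hli⟩ := h.exists_deriv (i := i) (j := j) (he _ ht1) (he _ ht2)
    (fun h => hij (congrArg Prod.fst h)) (by
      rw [hi _ ⟨ht1.1.le, ht1.2.le⟩, hj _ ⟨ht2.1.le, ht2.2.le⟩, hvr]
      push_cast
      ring)
  have e1 := hv'.unique (deriv i v hi _ ht1)
  have e2 := hw'.unique (deriv j w hj _ ht2)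
  rw [LinearIndependent.pair_iff] at hli
  have := hli 1 (-r) (by
    rw [e1, e2, hvr, Complex.real_smul, Complex.real_smul]
    push_cast
    ring)
  exact one_ne_zero this.1

theorem eq_zero_of_mul_eq_mul_of_neg_div_mem_slitPlane {v w : ℂ}
    (h : -(v / w) ∈ Complex.slitPlane) {σ τ : ℝ} (hσ : 0 ≤ σ) (hτ : 0 ≤ τ)
    (e : (σ : ℂ) * v = τ * w) : σ = 0 ∧ τ = 0 := by
  have hw : w ≠ 0 := by rintro rfl; simp at h
  have hσ0 : σ = 0 := by
    by_contra hne
    have hne' : (σ : ℂ) ≠ 0 := by exact_mod_cast hne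
    have : v / w = ((τ / σ : ℝ) : ℂ) := by
      push_cast
      field_simp
      linear_combination e
    rw [this, Complex.neg_ofReal_mem_slitPlane] at h
    exact absurd h (not_lt.2 (div_nonneg hτ hσ))
  subst hσ0
  simpa [hw, eq_comm] using e

theorem IsCompact.finite_of_eventually_eq {X : Type*} [TopologicalSpace X] {s : Set X}
    (hs : IsCompact s) (h : ∀ x ∈ s, ∀ᶠ y in nhds x, y ∈ s → y = x) : s.Finite := by
  obtain ⟨t, hsub⟩ := hs.elim_nhds_subcover' (fun x _ => {y | y ∈ s → y = x}) (fun x hx => h x hx)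
  refine (t.finite_toSet.image Subtype.val).subset fun y hy => ?_
  have hy' := hsub hy
  obtain ⟨x, hx, hyx⟩ := Set.mem_iUnion₂.1 hy'
  exact ⟨x, hx, (hyx hy).symm⟩

theorem InGeneralPosition.exists_start_ray (h : InGeneralPosition p) {i : ι} (hp : IsPLPath (p i)) :
    ∃ δ > (0 : ℝ), δ ≤ 1 ∧ ∃ v : ℂ, v ≠ 0 ∧
      ∀ τ ∈ Set.Icc 0 δ, (p i).extend (0 + 1 * τ) = A + τ * v := by
  obtain ⟨δ, hδ, hδ1, v, hv⟩ := hp.exists_affine_right (s := 0) (by simp)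
  refine ⟨δ, hδ, by linarith, v, ?_, fun τ hτ => ?_⟩
  · rintro rfl
    have := hv δ ⟨hδ.le, le_rfl⟩
    rw [zero_add, mul_zero, add_zero, Path.extend_zero] at this
    exact hδ.ne' (h.eq_zero_of_extend_eq ⟨hδ.le, by linarith⟩ this)
  · rw [one_mul, hv τ hτ, Path.extend_zero]

theorem InGeneralPosition.exists_end_ray (h : InGeneralPosition p) {i : ι} (hp : IsPLPath (p i)) :
    ∃ δ > (0 : ℝ), δ ≤ 1 ∧ ∃ v : ℂ, v ≠ 0 ∧
      ∀ τ ∈ Set.Icc 0 δ, (p i).extend (1 + (-1) * τ) = B + τ * v := by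
  obtain ⟨δ, hδ, hδ1, v, hv⟩ := hp.exists_affine_left (s := 1) (by simp)
  refine ⟨δ, hδ, by linarith, v, ?_, fun τ hτ => ?_⟩
  · rintro rfl
    have := hv δ ⟨hδ.le, le_rfl⟩
    rw [mul_zero, add_zero, Path.extend_one] at this
    linarith [h.eq_one_of_extend_eq ⟨by linarith, by linarith⟩ this]
  · rw [neg_one_mul, ← sub_eq_add_neg, hv τ hτ, Path.extend_one]

/-- Near a common endpoint, two different paths of the family meet at that endpoint only. -/
theorem InGeneralPosition.eventually_ne_of_rays (h : InGeneralPosition p) {i j : ι} (hij : i ≠ j)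
    {e κ δ δ' : ℝ} {x₀ v w : ℂ} (hκ : κ * κ = 1) (hδ : 0 < δ) (hδ' : 0 < δ')
    (he : ∀ τ ∈ Set.Ioo 0 (min δ δ'), e + κ * τ ∈ Set.Ioo (0 : ℝ) 1)
    (hpos : ∀ s ∈ Set.Icc (0 : ℝ) 1, 0 ≤ κ * (s - e))
    (hi : ∀ τ ∈ Set.Icc 0 δ, (p i).extend (e + κ * τ) = x₀ + τ * v)
    (hj : ∀ τ ∈ Set.Icc 0 δ', (p j).extend (e + κ * τ) = x₀ + τ * w)
    (hv : v ≠ 0) (hw : w ≠ 0) :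
    ∀ᶠ z : ℝ × ℝ in nhds (e, e), z.1 ∈ Set.Icc (0 : ℝ) 1 → z.2 ∈ Set.Icc (0 : ℝ) 1 →
      (p i).extend z.1 = (p j).extend z.2 → z = (e, e) := by
  have hs := h.neg_div_mem_slitPlane hij hκ (lt_min hδ hδ') he
    (fun τ hτ => hi τ ⟨hτ.1, hτ.2.trans (min_le_left _ _)⟩)
    (fun τ hτ => hj τ ⟨hτ.1, hτ.2.trans (min_le_right _ _)⟩) hv hw
  have c1 : Filter.Tendsto (fun z : ℝ × ℝ => κ * (z.1 - e)) (nhds (e, e)) (nhds 0) := by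
    have : Continuous fun z : ℝ × ℝ => κ * (z.1 - e) := by fun_prop
    simpa using this.tendsto (e, e)
  have c2 : Filter.Tendsto (fun z : ℝ × ℝ => κ * (z.2 - e)) (nhds (e, e)) (nhds 0) := by
    have : Continuous fun z : ℝ × ℝ => κ * (z.2 - e) := by fun_prop
    simpa using this.tendsto (e, e)
  filter_upwards [c1 (Iio_mem_nhds hδ), c2 (Iio_mem_nhds hδ')] with z h1 h2 m1 m2 heq
  have k1 := hi (κ * (z.1 - e)) ⟨hpos _ m1, le_of_lt h1⟩
  have k2 := hj (κ * (z.2 - e)) ⟨hpos _ m2, le_of_lt h2⟩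
  rw [show e + κ * (κ * (z.1 - e)) = z.1 by linear_combination (z.1 - e) * hκ] at k1
  rw [show e + κ * (κ * (z.2 - e)) = z.2 by linear_combination (z.2 - e) * hκ] at k2
  rw [k1, k2] at heq
  obtain ⟨z1, z2⟩ := eq_zero_of_mul_eq_mul_of_neg_div_mem_slitPlane hs (hpos _ m1) (hpos _ m2)
    (add_left_cancel heq)
  refine Prod.ext ?_ ?_
  · linear_combination κ * z1 - (z.1 - e) * hκ
  · linear_combination κ * z2 - (z.2 - e) * hκ

theorem InGeneralPosition.eventually_ne_of_interior (h : InGeneralPosition p)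
    (hp : ∀ i, IsPLPath (p i)) {i j : ι} (hij : i ≠ j) {s t : ℝ} (hs : s ∈ Set.Ioo (0 : ℝ) 1)
    (ht : t ∈ Set.Ioo (0 : ℝ) 1) (e : (p i).extend s = (p j).extend t) :
    ∀ᶠ z : ℝ × ℝ in nhds (s, t), (p i).extend z.1 = (p j).extend z.2 → z = (s, t) := by
  obtain ⟨v, w, hv, hw, hli⟩ := h.exists_deriv hs ht (fun h => hij (congrArg Prod.fst h)) e
  obtain ⟨δ, hδ, -, -, hi⟩ := (hp i).exists_affine_of_hasDerivAt hs hv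
  obtain ⟨δ', hδ', -, -, hj⟩ := (hp j).exists_affine_of_hasDerivAt ht hw
  have c1 : Filter.Tendsto (fun z : ℝ × ℝ => |z.1 - s|) (nhds (s, t)) (nhds 0) := by
    have : Continuous fun z : ℝ × ℝ => |z.1 - s| := by fun_prop
    simpa using this.tendsto (s, t)
  have c2 : Filter.Tendsto (fun z : ℝ × ℝ => |z.2 - t|) (nhds (s, t)) (nhds 0) := by
    have : Continuous fun z : ℝ × ℝ => |z.2 - t| := by fun_prop
    simpa using this.tendsto (s, t)
  filter_upwards [c1 (Iio_mem_nhds hδ), c2 (Iio_mem_nhds hδ')] with z h1 h2 heq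
  have k1 := hi (z.1 - s) (le_of_lt h1)
  have k2 := hj (z.2 - t) (le_of_lt h2)
  rw [add_sub_cancel] at k1 k2
  rw [k1, k2, e] at heq
  rw [LinearIndependent.pair_iff] at hli
  obtain ⟨z1, z2⟩ := hli (z.1 - s) (-(z.2 - t)) (by
    rw [Complex.real_smul, Complex.real_smul]
    push_cast at heq ⊢
    linear_combination heq)
  exact Prod.ext (by linarith) (by linarith)

/-- Two different paths of the family meet only finitely often. -/
theorem InGeneralPosition.finite_intersections (h : InGeneralPosition p)
    (hp : ∀ i, IsPLPath (p i)) {i j : ι} (hij : i ≠ j) :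
    {z : ℝ × ℝ | z.1 ∈ Set.Icc (0 : ℝ) 1 ∧ z.2 ∈ Set.Icc (0 : ℝ) 1 ∧
      (p i).extend z.1 = (p j).extend z.2}.Finite := by
  have hcomp : IsCompact {z : ℝ × ℝ | z.1 ∈ Set.Icc (0 : ℝ) 1 ∧ z.2 ∈ Set.Icc (0 : ℝ) 1 ∧
      (p i).extend z.1 = (p j).extend z.2} := by
    have : IsClosed {z : ℝ × ℝ | (p i).extend z.1 = (p j).extend z.2} :=
      isClosed_eq (by fun_prop) (by fun_prop)
    convert ((isCompact_Icc (a := (0 : ℝ)) (b := 1)).prod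
      (isCompact_Icc (a := (0 : ℝ)) (b := 1))).inter_right this using 1
    ext z
    simp only [Set.mem_ofPred_eq, Set.mem_inter_iff, Set.mem_prod, and_assoc]
  refine hcomp.finite_of_eventually_eq ?_
  rintro ⟨s, t⟩ ⟨hs, ht, e⟩
  simp only at hs ht e
  by_cases hs0 : s = 0
  · subst hs0
    rw [Path.extend_zero] at e
    have ht0 := h.eq_zero_of_extend_eq ht e.symm
    subst ht0
    obtain ⟨δ, hδ, hδ1, v, hv, hi⟩ := h.exists_start_ray (hp i)
    obtain ⟨δ', hδ', hδ1', w, hw, hj⟩ := h.exists_start_ray (hp j)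
    filter_upwards [h.eventually_ne_of_rays hij (by norm_num) hδ hδ'
      (fun τ hτ => ⟨by linarith [hτ.1], by linarith [hτ.2, min_le_left δ δ']⟩)
      (fun s hs => by linarith [hs.1]) hi hj hv hw] with z hz hm
    exact hz hm.1 hm.2.1 hm.2.2
  by_cases hs1 : s = 1
  · subst hs1
    rw [Path.extend_one] at e
    have ht1 := h.eq_one_of_extend_eq ht e.symm
    subst ht1
    obtain ⟨δ, hδ, hδ1, v, hv, hi⟩ := h.exists_end_ray (hp i)
    obtain ⟨δ', hδ', hδ1', w, hw, hj⟩ := h.exists_end_ray (hp j)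
    filter_upwards [h.eventually_ne_of_rays hij (by norm_num) hδ hδ'
      (fun τ hτ => ⟨by linarith [hτ.2, min_le_left δ δ'], by linarith [hτ.1]⟩)
      (fun s hs => by linarith [hs.2]) hi hj hv hw] with z hz hm
    exact hz hm.1 hm.2.1 hm.2.2
  have hs' : s ∈ Set.Ioo (0 : ℝ) 1 := ⟨hs.1.lt_of_ne (Ne.symm hs0), hs.2.lt_of_ne hs1⟩
  filter_upwards [h.eventually_ne_of_interior hp hij hs' (h.mem_Ioo_of_extend_eq hs' ht e) e]
    with z hz hm
  exact hz hm.2.2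

end GeneralPosition

/-! ### A parity count along an interval -/

theorem eq_of_forall_eventually_eq {α : Type*} {f : ℝ → α} {T : Set ℝ} (hT : IsPreconnected T)
    (h : ∀ s ∈ T, ∀ᶠ u in nhds s, f u = f s) {x y : ℝ} (hx : x ∈ T) (hy : y ∈ T) : f x = f y := by
  let _ : TopologicalSpace α := ⊥
  have : DiscreteTopology α := ⟨rfl⟩
  refine hT.constant (f := f) (fun s hs => ?_) hx hy
  exact (tendsto_const_nhds.congr' ((h s hs).mono fun u hu => hu.symm)).mono_left
    nhdsWithin_le_nhds

/-- Let `g` be a locally constant function on `(0, 1)` with values in `ZMod 2`, except at finitely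
many times, where it jumps by its value at that time. Then its total change is the sum of
these values. -/
theorem eq_add_sum_of_jumps {g : ℝ → ZMod 2} {K : Finset ℝ}
    (hreg : ∀ s ∈ Set.Ioo (0 : ℝ) 1, s ∉ K → ∀ᶠ u in nhds s, g u = g s)
    (hK : ∀ s ∈ K, ∃ l r, (∀ᶠ u in nhdsWithin s (Set.Iio s), g u = l) ∧
      (∀ᶠ u in nhdsWithin s (Set.Ioi s), g u = r) ∧ l + r = g s)
    {x y : ℝ} (hx : x ∈ Set.Ioo (0 : ℝ) 1) (hy : y ∈ Set.Ioo (0 : ℝ) 1)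
    (hxK : ∀ k ∈ K, x < k) (hyK : ∀ k ∈ K, k < y) : g y = g x + ∑ k ∈ K, g k := by
  choose! l r hl hr hlr using hK
  -- the left-continuous modification of `g`, with the jumps at earlier times removed
  set h : ℝ → ZMod 2 := fun u => (if u ∈ K then l u else g u) + ∑ k ∈ K, if k < u then g k else 0
    with hh
  have key : ∀ s ∈ Set.Ioo (0 : ℝ) 1, ∀ᶠ u in nhds s, h u = h s := by
    intro s hs
    have left : ∀ᶠ u in nhdsWithin s (Set.Iio s), ∀ k ∈ K, (k < u ↔ k < s) ∧ k ≠ u := by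
      rw [Filter.eventually_all_finset]
      intro k _
      rcases lt_or_ge k s with hks | hks
      · filter_upwards [nhdsWithin_le_nhds (Ioi_mem_nhds hks)] with u hu
        exact ⟨⟨fun _ => hks, fun _ => hu⟩, ne_of_lt hu⟩
      · filter_upwards [self_mem_nhdsWithin] with u (hu : u < s)
        exact ⟨⟨fun h => h.trans hu, fun h => absurd h (not_lt.2 hks)⟩, (hu.trans_le hks).ne'⟩
    have right : ∀ᶠ u in nhdsWithin s (Set.Ioi s), ∀ k ∈ K, (k < u ↔ k ≤ s) ∧ k ≠ u := by
      rw [Filter.eventually_all_finset]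
      intro k _
      rcases lt_or_ge s k with hks | hks
      · filter_upwards [nhdsWithin_le_nhds (Iio_mem_nhds hks)] with u (hu : u < k)
        exact ⟨⟨fun h => absurd h (not_lt.2 hu.le), fun h => absurd h (not_le.2 hks)⟩, hu.ne'⟩
      · filter_upwards [self_mem_nhdsWithin] with u (hu : s < u)
        exact ⟨⟨fun _ => hks, fun h => h.trans_lt hu⟩, (hks.trans_lt hu).ne⟩
    have hsum : (∑ k ∈ K, if k ≤ s then g k else 0) =
        (∑ k ∈ K, if k < s then g k else 0) + if s ∈ K then g s else 0 := by
      rw [← Finset.sum_ite_eq K s g, ← Finset.sum_add_distrib]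
      refine Finset.sum_congr rfl fun k _ => ?_
      rcases lt_trichotomy k s with h | h | h
      · simp [h, h.le, h.ne']
      · simp [h]
      · simp [not_lt.2 h.le, not_le.2 h, h.ne]
    have main : ∀ᶠ u in nhdsWithin s {s}ᶜ, h u = h s := by
      rw [← nhdsLT_sup_nhdsGT, Filter.eventually_sup]
      by_cases hsK : s ∈ K
      · constructor
        · filter_upwards [left, hl s hsK] with u hu hul
          have huK : u ∉ K := fun h => (hu u h).2 rfl
          simp only [hh, if_neg huK, if_pos hsK, hul]
          congr 1
          exact Finset.sum_congr rfl fun k hk => by simp only [(hu k hk).1]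
        · filter_upwards [right, hr s hsK] with u hu hur
          have huK : u ∉ K := fun h => (hu u h).2 rfl
          have : (∑ k ∈ K, if k < u then g k else 0) = ∑ k ∈ K, if k ≤ s then g k else 0 :=
            Finset.sum_congr rfl fun k hk => by simp only [(hu k hk).1]
          simp only [hh, if_neg huK, if_pos hsK, hur, this, hsum, ← hlr s hsK]
          linear_combination CharTwo.add_self_eq_zero (r s)
      · have hg := hreg s hs hsK
        constructor
        · filter_upwards [left, nhdsWithin_le_nhds hg] with u hu hul
          have huK : u ∉ K := fun h => (hu u h).2 rfl
          simp only [hh, if_neg huK, if_neg hsK]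
          rw [show g u = g s from hul]
          congr 1
          exact Finset.sum_congr rfl fun k hk => by simp only [(hu k hk).1]
        · filter_upwards [right, nhdsWithin_le_nhds hg] with u hu hur
          have huK : u ∉ K := fun h => (hu u h).2 rfl
          have : (∑ k ∈ K, if k < u then g k else 0) = ∑ k ∈ K, if k ≤ s then g k else 0 :=
            Finset.sum_congr rfl fun k hk => by simp only [(hu k hk).1]
          simp only [hh, if_neg huK, if_neg hsK, this, hsum, add_zero]
          rw [show g u = g s from hur]
    rw [eventually_nhdsWithin_iff] at main
    filter_upwards [main] with u hu
    by_cases hus : u = s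
    · rw [hus]
    · exact hu hus
  have e := eq_of_forall_eventually_eq isPreconnected_Ioo key hx hy
  have hxn : x ∉ K := fun h => lt_irrefl _ (hxK x h)
  have hyn : y ∉ K := fun h => lt_irrefl _ (hyK y h)
  simp only [hh, if_neg hxn, if_neg hyn] at e
  rw [Finset.sum_congr rfl fun k hk => if_neg (not_lt.2 (hxK k hk).le),
    Finset.sum_congr rfl fun k hk => if_pos (hyK k hk), Finset.sum_const_zero, add_zero] at e
  rw [e, add_assoc, CharTwo.add_self_eq_zero, add_zero]

/-! ### Three paths in general position -/

section ThreePaths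

variable {A B : ℂ} {p : Fin 3 → Path A B}

/-- The times in `(0, 1)` at which the `i`-th of three paths meets one of the other two. -/
def crossTimes (p : Fin 3 → Path A B) (i : Fin 3) : Set ℝ :=
  {s | s ∈ Set.Ioo (0 : ℝ) 1 ∧
    ∃ j, j ≠ i ∧ ∃ t ∈ Set.Icc (0 : ℝ) 1, (p i).extend s = (p j).extend t}

/-- The sign of a point with respect to the pair of paths other than the `i`-th one. -/
noncomputable def pairSign (p : Fin 3 → Path A B) (i : Fin 3) (x : ℂ) : ℂ :=
  turnSign (p (i + 1)).extend (p (i + 2)).extend x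

theorem finite_crossTimes (h : InGeneralPosition p) (hp : ∀ i, IsPLPath (p i)) (i : Fin 3) :
    (crossTimes p i).Finite := by
  refine (Set.finite_iUnion fun j : {j // j ≠ i} =>
    (h.finite_intersections hp (Ne.symm j.2)).image Prod.fst).subset ?_
  rintro s ⟨hs, j, hj, t, ht, e⟩
  exact Set.mem_iUnion.2 ⟨⟨j, hj⟩, (s, t), ⟨⟨hs.1.le, hs.2.le⟩, ht, e⟩, rfl⟩

theorem ne_of_notMem_crossTimes {i j : Fin 3} (hj : j ≠ i) {s : ℝ} (hs : s ∈ Set.Ioo (0 : ℝ) 1)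
    (hK : s ∉ crossTimes p i) : ∀ t ∈ Set.Icc (0 : ℝ) 1, (p j).extend t ≠ (p i).extend s :=
  fun t ht e => hK ⟨hs, j, hj, t, ht, e.symm⟩

theorem fin_three_add_one_ne (i : Fin 3) : i + 1 ≠ i := by revert i; decide

theorem fin_three_add_two_ne (i : Fin 3) : i + 2 ≠ i := by revert i; decide

theorem fin_three_eq_or (i j : Fin 3) (h : j ≠ i) : j = i + 1 ∨ j = i + 2 := by
  revert i j; decide

theorem pairSign_eq_one_or {i : Fin 3} {s : ℝ} (hs : s ∈ Set.Ioo (0 : ℝ) 1)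
    (hK : s ∉ crossTimes p i) :
    pairSign p i ((p i).extend s) = 1 ∨ pairSign p i ((p i).extend s) = -1 :=
  turnSign_eq_one_or (by fun_prop) (by fun_prop) (by simp) (by simp)
    (ne_of_notMem_crossTimes (fin_three_add_one_ne i) hs hK)
    (ne_of_notMem_crossTimes (fin_three_add_two_ne i) hs hK)

theorem pairSign_eventually_eq {i : Fin 3} {s : ℝ} (hs : s ∈ Set.Ioo (0 : ℝ) 1)
    (hK : s ∉ crossTimes p i) :
    ∀ᶠ u in nhds s, pairSign p i ((p i).extend u) = pairSign p i ((p i).extend s) :=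
  ((p i).continuous_extend.tendsto s).eventually
    (turnSign_eventually_eq (by fun_prop) (by fun_prop) (by simp) (by simp)
      (ne_of_notMem_crossTimes (fin_three_add_one_ne i) hs hK)
      (ne_of_notMem_crossTimes (fin_three_add_two_ne i) hs hK))

theorem pairSign_eq_of_isPreconnected {i : Fin 3} {T : Set ℝ} (hT : IsPreconnected T)
    (h01 : T ⊆ Set.Ioo 0 1) (hK : ∀ s ∈ T, s ∉ crossTimes p i) {x y : ℝ} (hx : x ∈ T)
    (hy : y ∈ T) : pairSign p i ((p i).extend x) = pairSign p i ((p i).extend y) :=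
  eq_of_forall_eventually_eq (f := fun u => pairSign p i ((p i).extend u)) hT
    (fun s hs => pairSign_eventually_eq (h01 hs) (hK s hs)) hx hy

theorem turnSign_extend_crossing (h : InGeneralPosition p) (hp : ∀ i, IsPLPath (p i))
    {i j k : Fin 3} (hij : i ≠ j) (hik : i ≠ k) (hjk : j ≠ k) {s t : ℝ}
    (hs : s ∈ Set.Ioo (0 : ℝ) 1) (ht : t ∈ Set.Ioo (0 : ℝ) 1)
    (e : (p i).extend s = (p j).extend t) :
    ∃ ε₀ > (0 : ℝ), ∀ ε ∈ Set.Ioo 0 ε₀,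
      turnSign (p j).extend (p k).extend ((p i).extend (s + ε)) =
        -turnSign (p j).extend (p k).extend ((p i).extend (s - ε)) := by
  obtain ⟨v, w, hv, hw, hli⟩ := h.exists_deriv hs ht (fun h => hij (congrArg Prod.fst h)) e
  obtain ⟨δ, hδ, -, -, hi⟩ := (hp i).exists_affine_of_hasDerivAt hs hv
  obtain ⟨η, hη, hη0, hη1, hj⟩ := (hp j).exists_affine_of_hasDerivAt ht hw
  rw [← e] at hj
  have hs' : s ∈ Set.Icc (0 : ℝ) 1 := ⟨hs.1.le, hs.2.le⟩
  obtain ⟨ε₀, hε₀, key⟩ := turnSign_crossing (f := (p j).extend) (g := (p k).extend)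
    (by fun_prop) (by fun_prop) (by simp) (by simp) hη hη0 hη1 hj hli.det_ne_zero_of_pair
    (by
      intro t' ht' e'
      by_contra hne
      have ht'' := h.mem_Ioo_of_extend_eq hs ht' e'.symm
      exact h.no_triple_extend hs ht ht'' (fun h => hij (congrArg Prod.fst h))
        (fun h => hne (congrArg Prod.snd h).symm) (fun h => hij (congrArg Prod.fst h))
        e (e.symm.trans e'.symm))
    (by
      intro u hu e'
      have hu' := h.mem_Ioo_of_extend_eq hs hu e'.symm
      exact h.no_triple_extend hs ht hu' (fun h => hij (congrArg Prod.fst h))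
        (fun h => hjk (congrArg Prod.fst h)) (fun h => hik (congrArg Prod.fst h))
        e (e.symm.trans e'.symm))
  refine ⟨min ε₀ δ, lt_min hε₀ hδ, fun ε hε => ?_⟩
  obtain ⟨h1, h2⟩ := lt_min_iff.1 hε.2
  have a1 := hi ε (by rw [abs_of_pos hε.1]; exact h2.le)
  have a2 := hi (-ε) (by rw [abs_neg, abs_of_pos hε.1]; exact h2.le)
  rw [← sub_eq_add_neg, Complex.ofReal_neg, neg_mul, ← sub_eq_add_neg] at a2
  rw [a1, a2]
  exact key ε ⟨hε.1, h1⟩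

theorem pairSign_crossing (h : InGeneralPosition p) (hp : ∀ i, IsPLPath (p i)) {i : Fin 3} {s : ℝ}
    (hs : s ∈ crossTimes p i) :
    ∃ ε₀ > (0 : ℝ), ∀ ε ∈ Set.Ioo 0 ε₀,
      pairSign p i ((p i).extend (s + ε)) = -pairSign p i ((p i).extend (s - ε)) := by
  obtain ⟨hs, j, hj, t, ht, e⟩ := hs
  have ht' := h.mem_Ioo_of_extend_eq hs ht e
  have hne : i + 1 ≠ i + 2 := by simp
  rcases fin_three_eq_or i j hj with rfl | rfl
  · exact turnSign_extend_crossing h hp (fin_three_add_one_ne i).symm (fin_three_add_two_ne i).symm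
      hne hs ht' e
  · obtain ⟨ε₀, hε₀, key⟩ := turnSign_extend_crossing h hp (fin_three_add_two_ne i).symm
      (fin_three_add_one_ne i).symm hne.symm hs ht' e
    refine ⟨ε₀, hε₀, fun ε hε => ?_⟩
    rw [pairSign, pairSign, ← turnSign_inv, key ε hε, inv_neg, turnSign_inv]

theorem prod_pairSign_near_start (h : InGeneralPosition p) (hp : ∀ i, IsPLPath (p i)) :
    ∃ s₀ > (0 : ℝ), ∀ s ∈ Set.Ioo 0 s₀,
      pairSign p 0 ((p 0).extend s) * pairSign p 1 ((p 1).extend s) *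
        pairSign p 2 ((p 2).extend s) = -1 := by
  choose δ hδ hδ1 v hv hray using fun i => h.exists_start_ray (hp i)
  obtain ⟨t₁, ht₁, hmin⟩ : ∃ t₁ > (0 : ℝ), ∀ i, t₁ ≤ δ i :=
    ⟨min (δ 0) (min (δ 1) (δ 2)), by simp [hδ], fun i => by fin_cases i <;> simp⟩
  have hloc : ∀ i, ∀ t ∈ Set.Icc 0 t₁, (p i).extend t = A + t * v i := fun i t ht => by
    simpa using hray i t ⟨ht.1, ht.2.trans (hmin i)⟩
  have ht₁' : t₁ ≤ 1 := (hmin 0).trans (hδ1 0)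
  have hA : ∀ i, ∀ t ∈ Set.Icc t₁ 1, (p i).extend t ≠ A := fun i t ht e =>
    (ht₁.trans_le ht.1).ne' (h.eq_zero_of_extend_eq ⟨ht₁.le.trans ht.1, ht.2⟩ e)
  have hdir : ∀ i j, i ≠ j → -(v i / v j) ∈ Complex.slitPlane := fun i j hij =>
    h.neg_div_mem_slitPlane hij (e := 0) (κ := 1) (x₀ := A) (by norm_num) ht₁
      (fun τ hτ => ⟨by linarith [hτ.1], by linarith [hτ.2]⟩)
      (fun τ hτ => hray i τ ⟨hτ.1, hτ.2.trans (hmin i)⟩)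
      (fun τ hτ => hray j τ ⟨hτ.1, hτ.2.trans (hmin j)⟩) (hv i) (hv j)
  exact prod_halfTurn_near_start (p 0).continuous_extend (p 1).continuous_extend
    (p 2).continuous_extend (p 0).extend_one (p 1).extend_one (p 2).extend_one ht₁ ht₁'
    (hloc 0) (hloc 1) (hloc 2) (hA 0) (hA 1) (hA 2) (hdir 0 1 (by decide)) (hdir 1 2 (by decide))
    (hdir 2 0 (by decide))

theorem joinedIn_extend {γ : Path A B} {S : Set ℂ} {x y : ℝ} (hxy : x ≤ y)
    (h : ∀ u ∈ Set.Icc x y, γ.extend u ∈ S) : JoinedIn S (γ.extend x) (γ.extend y) := by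
  have := ((convex_Icc x y).isPathConnected ⟨x, Set.left_mem_Icc.2 hxy⟩).image γ.continuous_extend
  refine (this.joinedIn _ ⟨x, Set.left_mem_Icc.2 hxy, rfl⟩ _
    ⟨y, Set.right_mem_Icc.2 hxy, rfl⟩).mono ?_
  rintro _ ⟨u, hu, rfl⟩
  exact h u hu

theorem joinedIn_extend_iff {γ : Path A B} {S : Set ℂ} {z : ℂ} {x y : ℝ}
    (h : ∀ u ∈ Set.uIcc x y, γ.extend u ∈ S) :
    JoinedIn S z (γ.extend x) ↔ JoinedIn S z (γ.extend y) := by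
  rcases le_total x y with hxy | hxy
  · rw [Set.uIcc_of_le hxy] at h
    exact ⟨fun k => k.trans (joinedIn_extend hxy h), fun k => k.trans (joinedIn_extend hxy h).symm⟩
  · rw [Set.uIcc_of_ge hxy] at h
    exact ⟨fun k => k.trans (joinedIn_extend hxy h).symm, fun k => k.trans (joinedIn_extend hxy h)⟩

open Classical in
/-- The indicator function, with values in `ZMod 2`, of the times at which a path is in the path
component of `A` in `S`. -/
noncomputable def joinInd (S : Set ℂ) (γ : Path A B) (u : ℝ) : ZMod 2 :=
  if JoinedIn S A (γ.extend u) then 1 else 0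

theorem joinInd_congr {S : Set ℂ} {γ : Path A B} {x y : ℝ}
    (h : ∀ u ∈ Set.uIcc x y, γ.extend u ∈ S) : joinInd S γ x = joinInd S γ y := by
  have e : JoinedIn S A (γ.extend x) ↔ JoinedIn S A (γ.extend y) := joinedIn_extend_iff h
  rw [joinInd, joinInd]
  split_ifs with h1 h2 h2
  · rfl
  · exact absurd (e.1 h1) h2
  · exact absurd (e.2 h2) h1
  · rfl

theorem joinInd_eq_zero {S : Set ℂ} {γ : Path A B} {x : ℝ} (h : γ.extend x ∉ S) :
    joinInd S γ x = 0 :=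
  if_neg fun k => h k.target_mem

end ThreePaths

/-! ### The path component of the starting point -/

section Join

variable {A B : ℂ} {p : Fin 3 → Path A B} {S : Set ℂ}

theorem joinInd_eventually_eq {i : Fin 3} (hfin : (crossTimes p i).Finite)
    (hS : ∀ s ∈ Set.Ioo (0 : ℝ) 1, s ∉ crossTimes p i →
      ((p i).extend s ∈ S ↔ pairSign p i ((p i).extend s) = -1))
    {s : ℝ} (hs : s ∈ Set.Ioo (0 : ℝ) 1) (hK : s ∉ crossTimes p i) :
    ∀ᶠ u in nhds s, joinInd S (p i) u = joinInd S (p i) s := by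
  have hev : ∀ᶠ u in nhds s, u ∈ Set.Ioo (0 : ℝ) 1 ∧ u ∉ crossTimes p i ∧
      pairSign p i ((p i).extend u) = pairSign p i ((p i).extend s) :=
    Filter.Eventually.and (Ioo_mem_nhds hs.1 hs.2) (Filter.Eventually.and
      (hfin.isClosed.isOpen_compl.mem_nhds hK) (pairSign_eventually_eq hs hK))
  obtain ⟨δ, hδ, hball⟩ := Metric.eventually_nhds_iff_ball.1 hev
  filter_upwards [Metric.ball_mem_nhds s hδ] with u hu
  by_cases hsign : pairSign p i ((p i).extend s) = -1
  · refine joinInd_congr fun t ht => ?_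
    have htb : t ∈ Metric.ball s δ :=
      (convex_ball s δ).ordConnected.uIcc_subset hu (Metric.mem_ball_self hδ) ht
    obtain ⟨t1, t2, t3⟩ := hball t htb
    exact (hS t t1 t2).2 (t3.trans hsign)
  · obtain ⟨u1, u2, u3⟩ := hball u hu
    rw [joinInd_eq_zero fun h => hsign ((hS s hs hK).1 h),
      joinInd_eq_zero fun h => hsign (u3.symm.trans ((hS u u1 u2).1 h))]

/-- At a crossing of two different paths, exactly one of the two branches of each path is
sheltered, and this branch is joined to the crossing point. -/
theorem joinInd_crossing (h : InGeneralPosition p) (hp : ∀ i, IsPLPath (p i)) {i : Fin 3}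
    (hS : ∀ s ∈ Set.Ioo (0 : ℝ) 1, s ∉ crossTimes p i →
      ((p i).extend s ∈ S ↔ pairSign p i ((p i).extend s) = -1))
    {s : ℝ} (hs : s ∈ crossTimes p i) (hsS : (p i).extend s ∈ S) :
    ∃ l r, (∀ᶠ u in nhdsWithin s (Set.Iio s), joinInd S (p i) u = l) ∧
      (∀ᶠ u in nhdsWithin s (Set.Ioi s), joinInd S (p i) u = r) ∧ l + r = joinInd S (p i) s := by
  have hev : ∀ᶠ u in nhds s, u ∈ Set.Ioo (0 : ℝ) 1 ∧ u ∉ crossTimes p i \ {s} :=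
    Filter.Eventually.and (Ioo_mem_nhds hs.1.1 hs.1.2)
      (((finite_crossTimes h hp i).subset Set.sdiff_subset).isClosed.isOpen_compl.mem_nhds
        fun h => h.2 rfl)
  obtain ⟨δ, hδ, hball⟩ := Metric.eventually_nhds_iff_ball.1 hev
  have hnear : ∀ u, |u - s| < δ → u ≠ s → u ∈ Set.Ioo (0 : ℝ) 1 ∧ u ∉ crossTimes p i :=
    fun u hu hne => ⟨(hball u hu).1, fun k => (hball u hu).2 ⟨k, hne⟩⟩
  have hL : ∀ u ∈ Set.Ioo (s - δ) s, u ∈ Set.Ioo (0 : ℝ) 1 ∧ u ∉ crossTimes p i := fun u hu =>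
    hnear u (abs_lt.2 ⟨by linarith [hu.1], by linarith [hu.2]⟩) hu.2.ne
  have hR : ∀ u ∈ Set.Ioo s (s + δ), u ∈ Set.Ioo (0 : ℝ) 1 ∧ u ∉ crossTimes p i := fun u hu =>
    hnear u (abs_lt.2 ⟨by linarith [hu.1], by linarith [hu.2]⟩) hu.1.ne'
  obtain ⟨ε₀, hε₀, hflip⟩ := pairSign_crossing h hp hs
  set ε := min ε₀ δ / 2 with hε
  have hm : 0 < min ε₀ δ := lt_min hε₀ hδ
  have hεp : 0 < ε := by positivity
  have hε1 : ε < ε₀ := by linarith [min_le_left ε₀ δ]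
  have hε2 : ε < δ := by linarith [min_le_right ε₀ δ]
  have hflip := hflip ε ⟨hεp, hε1⟩
  have mL : s - ε ∈ Set.Ioo (s - δ) s := ⟨by linarith, by linarith⟩
  have mR : s + ε ∈ Set.Ioo s (s + δ) := ⟨by linarith, by linarith⟩
  have cL : ∀ u ∈ Set.Ioo (s - δ) s,
      pairSign p i ((p i).extend u) = pairSign p i ((p i).extend (s - ε)) := fun u hu =>
    pairSign_eq_of_isPreconnected isPreconnected_Ioo (fun u hu => (hL u hu).1)
      (fun u hu => (hL u hu).2) hu mL
  have cR : ∀ u ∈ Set.Ioo s (s + δ),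
      pairSign p i ((p i).extend u) = pairSign p i ((p i).extend (s + ε)) := fun u hu =>
    pairSign_eq_of_isPreconnected isPreconnected_Ioo (fun u hu => (hR u hu).1)
      (fun u hu => (hR u hu).2) hu mR
  have nL : Set.Ioo (s - δ) s ∈ nhdsWithin s (Set.Iio s) := Ioo_mem_nhdsLT (by linarith)
  have nR : Set.Ioo s (s + δ) ∈ nhdsWithin s (Set.Ioi s) := Ioo_mem_nhdsGT (by linarith)
  rcases pairSign_eq_one_or (hL _ mL).1 (hL _ mL).2 with hl | hl
  · rw [hl] at hflip cL
    rw [hflip] at cR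
    refine ⟨0, joinInd S (p i) s, ?_, ?_, zero_add _⟩
    · filter_upwards [nL] with u hu
      refine joinInd_eq_zero fun k => ?_
      have := (hS u (hL u hu).1 (hL u hu).2).1 k
      rw [cL u hu] at this
      norm_num at this
    · filter_upwards [nR] with u hu
      refine joinInd_congr fun t ht => ?_
      rw [Set.uIcc_of_ge hu.1.le] at ht
      rcases ht.1.eq_or_lt with rfl | hlt
      · exact hsS
      · have htm : t ∈ Set.Ioo s (s + δ) := ⟨hlt, ht.2.trans_lt hu.2⟩
        exact (hS t (hR t htm).1 (hR t htm).2).2 (cR t htm)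
  · rw [hl] at hflip cL
    rw [hflip, neg_neg] at cR
    refine ⟨joinInd S (p i) s, 0, ?_, ?_, add_zero _⟩
    · filter_upwards [nL] with u hu
      refine joinInd_congr fun t ht => ?_
      rw [Set.uIcc_of_le hu.2.le] at ht
      rcases ht.2.eq_or_lt with rfl | hlt
      · exact hsS
      · have htm : t ∈ Set.Ioo (s - δ) s := ⟨hu.1.trans_le ht.1, hlt⟩
        exact (hS t (hL t htm).1 (hL t htm).2).2 (cL t htm)
    · filter_upwards [nR] with u hu
      refine joinInd_eq_zero fun k => ?_
      have := (hS u (hR u hu).1 (hR u hu).2).1 k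
      rw [cR u hu] at this
      norm_num at this

/-- The crossing points of different paths are paired up by their two parameters, so that every
function of the points sums up to `0` modulo `2` over all crossing times. -/
theorem sum_crossTimes_eq_zero (h : InGeneralPosition p) {K : Fin 3 → Finset ℝ}
    (hK : ∀ i s, s ∈ K i ↔ s ∈ crossTimes p i) (φ : ℂ → ZMod 2) :
    ∑ i, ∑ s ∈ K i, φ ((p i).extend s) = 0 := by
  rw [Finset.sum_sigma' Finset.univ K fun i s => φ ((p i).extend s)]
  set M : Finset (Σ _ : Fin 3, ℝ) := Finset.univ.sigma K with hM
  have hmem : ∀ z : Σ _ : Fin 3, ℝ, z ∈ M ↔ z.2 ∈ crossTimes p z.1 := fun z => by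
    simp [hM, hK]
  have hpartner : ∀ z : Σ _ : Fin 3, ℝ, z ∈ M → ∃ z' : Σ _ : Fin 3, ℝ,
      z' ∈ M ∧ z'.1 ≠ z.1 ∧ (p z'.1).extend z'.2 = (p z.1).extend z.2 := by
    intro z hz
    obtain ⟨hs, j, hj, t, ht, e⟩ := (hmem z).1 hz
    exact ⟨⟨j, t⟩, (hmem _).2 ⟨h.mem_Ioo_of_extend_eq hs ht e, z.1, hj.symm, z.2,
      ⟨hs.1.le, hs.2.le⟩, e.symm⟩, hj, e.symm⟩
  choose σ hσM hσ1 hσe using hpartner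
  refine Finset.sum_involution σ ?_ ?_ hσM ?_
  · intro z hz
    rw [hσe z hz, CharTwo.add_self_eq_zero]
  · intro z hz _ e
    exact hσ1 z hz (congrArg Sigma.fst e)
  · intro z hz
    by_contra hne
    have k1 := hσM z hz
    have k2 := hσM _ k1
    refine h.no_triple_extend ((hmem _).1 hz).1 ((hmem _).1 k1).1 ((hmem _).1 k2).1
      (fun e => hσ1 z hz (congrArg Prod.fst e).symm)
      (fun e => hσ1 _ k1 (congrArg Prod.fst e).symm) (fun e => hne ?_) (hσe z hz).symm
      (hσe _ k1).symm
    rw [Prod.mk.injEq] at e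
    exact Sigma.ext e.1.symm (heq_of_eq e.2.symm)

/-- If a set contains all crossings of different paths, and contains any other point of a path
exactly when it is enclosed by the other two paths, then it joins `A` to `B`. -/
theorem joinedIn_of_pairSign (h : InGeneralPosition p) (hp : ∀ i, IsPLPath (p i))
    (hA : A ∈ S) (hB : B ∈ S) (hcross : ∀ i, ∀ s ∈ crossTimes p i, (p i).extend s ∈ S)
    (hS : ∀ i, ∀ s ∈ Set.Ioo (0 : ℝ) 1, s ∉ crossTimes p i →
      ((p i).extend s ∈ S ↔ pairSign p i ((p i).extend s) = -1)) :
    JoinedIn S A B := by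
  set K : Fin 3 → Finset ℝ := fun i => (finite_crossTimes h hp i).toFinset with hKdef
  have hK : ∀ i s, s ∈ K i ↔ s ∈ crossTimes p i := fun i s => by simp [hKdef]
  have hKIoo : ∀ i, ∀ k ∈ K i, k ∈ Set.Ioo (0 : ℝ) 1 := fun i k hk => ((hK i k).1 hk).1
  obtain ⟨s₀, hs₀, hprod⟩ := prod_pairSign_near_start h hp
  obtain ⟨x, hx, hxs, hxK⟩ : ∃ x, x ∈ Set.Ioo (0 : ℝ) 1 ∧ x < s₀ ∧ ∀ i, ∀ k ∈ K i, x < k := by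
    have : ∀ᶠ x in nhdsWithin (0 : ℝ) (Set.Ioi 0), x ∈ Set.Ioo (0 : ℝ) 1 ∧ x < s₀ ∧
        ∀ i, ∀ k ∈ K i, x < k := by
      refine Filter.Eventually.and (Ioo_mem_nhdsGT one_pos) (Filter.Eventually.and
        (nhdsWithin_le_nhds (Iio_mem_nhds hs₀)) ?_)
      rw [Filter.eventually_all]
      intro i
      rw [Filter.eventually_all_finset]
      exact fun k hk => nhdsWithin_le_nhds (Iio_mem_nhds (hKIoo i k hk).1)
    exact this.exists
  obtain ⟨y, hy, hyK⟩ : ∃ y, y ∈ Set.Ioo (0 : ℝ) 1 ∧ ∀ i, ∀ k ∈ K i, k < y := by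
    have : ∀ᶠ y in nhdsWithin (1 : ℝ) (Set.Iio 1), y ∈ Set.Ioo (0 : ℝ) 1 ∧
        ∀ i, ∀ k ∈ K i, k < y := by
      refine Filter.Eventually.and (Ioo_mem_nhdsLT one_pos) ?_
      rw [Filter.eventually_all]
      intro i
      rw [Filter.eventually_all_finset]
      exact fun k hk => nhdsWithin_le_nhds (Ioi_mem_nhds (hKIoo i k hk).2)
    exact this.exists
  have hxn : ∀ i, ∀ u ∈ Set.Ioc 0 x, u ∈ Set.Ioo (0 : ℝ) 1 ∧ u ∉ crossTimes p i := fun i u hu =>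
    ⟨⟨hu.1, hu.2.trans_lt hx.2⟩, fun k => absurd (hxK i u ((hK i u).2 k)) (not_lt.2 hu.2)⟩
  have hyn : ∀ i, ∀ u ∈ Set.Ico y 1, u ∈ Set.Ioo (0 : ℝ) 1 ∧ u ∉ crossTimes p i := fun i u hu =>
    ⟨⟨hy.1.trans_le hu.1, hu.2⟩, fun k => absurd (hyK i u ((hK i u).2 k)) (not_lt.2 hu.1)⟩
  have hxx : x ∈ Set.Ioc 0 x := ⟨hx.1, le_rfl⟩
  have hyy : y ∈ Set.Ico y 1 := ⟨le_rfl, hy.2⟩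
  -- the initial piece of a path is joined to `A` if it is enclosed by the other two paths
  have start : ∀ i, joinInd S (p i) x =
      if pairSign p i ((p i).extend x) = -1 then 1 else 0 := by
    intro i
    split_ifs with hsign
    · refine if_pos ?_
      have := joinedIn_extend (γ := p i) (S := S) hx.1.le (fun u hu => by
        rcases hu.1.eq_or_lt with rfl | hu0
        · rwa [Path.extend_zero]
        · have hu' : u ∈ Set.Ioc 0 x := ⟨hu0, hu.2⟩
          exact (hS i u (hxn i u hu').1 (hxn i u hu').2).2
            ((pairSign_eq_of_isPreconnected isPreconnected_Ioc (fun t ht => (hxn i t ht).1)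
              (fun t ht => (hxn i t ht).2) hu' hxx).trans hsign))
      rwa [Path.extend_zero] at this
    · exact joinInd_eq_zero fun k => hsign ((hS i x (hxn i x hxx).1 (hxn i x hxx).2).1 k)
  have hsum0 : ∑ i, joinInd S (p i) x = 1 := by
    have hp3 := hprod x ⟨hx.1, hxs⟩
    have hne : (1 : ℂ) ≠ -1 := by norm_num
    rw [Fin.sum_univ_three, start, start, start]
    rcases pairSign_eq_one_or (hxn 0 x hxx).1 (hxn 0 x hxx).2 with e0 | e0 <;>
    rcases pairSign_eq_one_or (hxn 1 x hxx).1 (hxn 1 x hxx).2 with e1 | e1 <;>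
    rcases pairSign_eq_one_or (hxn 2 x hxx).1 (hxn 2 x hxx).2 with e2 | e2 <;>
    rw [e0, e1, e2] at hp3 ⊢ <;> norm_num at hp3 <;> norm_num
    decide
  have hstep : ∀ i, joinInd S (p i) y =
      joinInd S (p i) x + ∑ s ∈ K i, joinInd S (p i) s := fun i =>
    eq_add_sum_of_jumps
      (fun s hs hsK => joinInd_eventually_eq (finite_crossTimes h hp i) (hS i) hs
        fun k => hsK ((hK i s).2 k))
      (fun s hs => joinInd_crossing h hp (hS i) ((hK i s).1 hs) (hcross i s ((hK i s).1 hs)))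
      hx hy (hxK i) (hyK i)
  have hsum1 : ∑ i, joinInd S (p i) y = 1 := by
    rw [Finset.sum_congr rfl fun i _ => hstep i, Finset.sum_add_distrib, hsum0]
    classical
    rw [show ∑ i, ∑ s ∈ K i, joinInd S (p i) s = 0 from
      sum_crossTimes_eq_zero h hK fun z => if JoinedIn S A z then 1 else 0, add_zero]
  obtain ⟨i, -, hi⟩ := Finset.exists_ne_zero_of_sum_ne_zero (hsum1.trans_ne one_ne_zero)
  have hAy : JoinedIn S A ((p i).extend y) := by
    by_contra hc
    exact hi (if_neg hc)
  have hsign := (hS i y (hyn i y hyy).1 (hyn i y hyy).2).1 hAy.target_mem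
  have hyB := joinedIn_extend (γ := p i) (S := S) hy.2.le (fun u hu => by
    rcases hu.2.eq_or_lt with rfl | hu1
    · rwa [Path.extend_one]
    · have hu' : u ∈ Set.Ico y 1 := ⟨hu.1, hu1⟩
      exact (hS i u (hyn i u hu').1 (hyn i u hu').2).2
        ((pairSign_eq_of_isPreconnected isPreconnected_Ico (fun t ht => (hyn i t ht).1)
          (fun t ht => (hyn i t ht).2) hu' hyy).trans hsign))
  rw [Path.extend_one] at hyB
  exact hAy.trans hyB

end Join

/-! ### Winding numbers and strongly sheltered points -/

theorem HasWindingNumber.turnSign_eq {A B : ℂ} {q r : Path A B} {x : ℂ} {k : ℤ}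
    (h : HasWindingNumber (loopOf q r) x k) : turnSign q.extend r.extend x = (-1) ^ k := by
  obtain ⟨θ, hθ, hk⟩ := h
  set Θ : ℝ → ℂ := fun t => θ (Set.projIcc 0 1 zero_le_one t) with hΘ
  have hΘc : Continuous Θ := θ.continuous.comp continuous_projIcc
  have hexp : ∀ t ∈ Set.Icc (0 : ℝ) 1, Complex.exp (Θ t) = (loopOf q r).extend t - x := by
    intro t ht
    rw [hΘ, Path.extend_apply _ ht, hθ]
    simp only [Set.projIcc_of_mem zero_le_one ht]
  have hq : IsLogOn (fun t => Θ ((1 - t) / 2)) (fun t => q.extend t - x) 0 1 := by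
    refine ⟨(hΘc.comp (by fun_prop)).continuousOn, fun t ht => ?_⟩
    rw [hexp _ ⟨by linarith [ht.2], by linarith [ht.1]⟩, loopOf,
      Path.extend_trans_of_le_half _ _ (by linarith [ht.1]), Path.extend_symm_apply]
    congr 2
    ring
  have hr : IsLogOn (fun t => Θ ((1 + t) / 2)) (fun t => r.extend t - x) 0 1 := by
    refine ⟨(hΘc.comp (by fun_prop)).continuousOn, fun t ht => ?_⟩
    rw [hexp _ ⟨by linarith [ht.1], by linarith [ht.2]⟩, loopOf,
      Path.extend_trans_of_half_le _ _ (by linarith [ht.1])]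
    congr 2
    ring
  have h0 : Θ 0 = θ 0 := by simp [hΘ]
  have h1 : Θ 1 = θ 1 := by simp [hΘ]
  rw [turnSign, halfTurn, halfTurn, hq.logIncr_eq zero_le_one, hr.logIncr_eq zero_le_one,
    ← Complex.exp_sub, ← Complex.exp_pi_mul_I, ← Complex.exp_int_mul]
  congr 1
  norm_num
  rw [h0, h1]
  linear_combination hk / 2

theorem exists_hasWindingNumber {P : ℂ} {γ : Path P P} {x : ℂ} (hx : x ∉ Set.range γ) :
    ∃ k : ℤ, HasWindingNumber γ x k := by
  have h0 : ∀ t ∈ Set.Icc (0 : ℝ) 1, γ.extend t - x ≠ 0 := fun t ht e =>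
    hx ⟨⟨t, ht⟩, by rw [← Path.extend_apply γ ht]; exact sub_eq_zero.1 e⟩
  obtain ⟨θ, hθ, he⟩ := exists_isLogOn zero_le_one (f := fun t => γ.extend t - x)
    (by fun_prop) h0
  have hend : Complex.exp (θ 1) = Complex.exp (θ 0) := by
    rw [he 1 (by simp), he 0 (by simp)]
    simp only [Path.extend_one, Path.extend_zero]
  obtain ⟨k, hk⟩ := Complex.exp_eq_exp_iff_exists_int.1 hend
  refine ⟨k, ⟨fun t => θ t, ?_⟩, fun t => ?_, ?_⟩
  · exact hθ.comp_continuous continuous_subtype_val fun t => t.2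
  · have := he t t.2
    simp only [Path.extend_apply γ t.2] at this
    exact this.symm
  · change θ 1 - θ 0 = _
    rw [hk]
    ring

theorem exists_odd_hasWindingNumber_iff {A B : ℂ} {q r : Path A B} {x : ℂ} (hq : x ∉ Set.range q)
    (hr : x ∉ Set.range r) :
    (∃ k : ℤ, Odd k ∧ HasWindingNumber (loopOf q r) x k) ↔
      turnSign q.extend r.extend x = -1 := by
  constructor
  · rintro ⟨k, hk, h⟩
    rw [h.turnSign_eq, hk.neg_one_zpow]
  · intro h
    obtain ⟨k, hk⟩ := exists_hasWindingNumber (γ := loopOf q r) (x := x) (by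
      rw [loopOf, Path.trans_range, Path.symm_range]
      exact fun h => h.elim hq hr)
    refine ⟨k, ?_, hk⟩
    by_contra hodd
    have := hk.turnSign_eq
    rw [h, (Int.not_odd_iff_even.1 hodd).neg_one_zpow] at this
    norm_num at this

theorem lemma2p4 (A B : ℂ) (hAB : A ≠ B) (a b c : Path A B)
    (ha : IsPLPath a) (hb : IsPLPath b) (hc : IsPLPath c)
    (hgen : InGeneralPosition ![a, b, c]) :
    ∃ γ : Path A B, ∀ t : unitInterval,
      γ t ∈ Set.range a ∪ Set.range b ∪ Set.range c ∧ StronglySheltered a b c (γ t) := by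
  have hmem : ∀ (q : Path A B) (s : ℝ), q.extend s ∈ Set.range q := fun q s => by
    rw [← q.extend_range]
    exact ⟨s, rfl⟩
  have hrange : ∀ (q : Path A B) (x : ℂ), x ∈ Set.range q ↔
      ∃ t ∈ Set.Icc (0 : ℝ) 1, x = q.extend t := fun q x => by
    constructor
    · rintro ⟨t, rfl⟩
      exact ⟨t, t.2, (Path.extend_apply q t.2).symm⟩
    · rintro ⟨t, -, rfl⟩
      exact hmem q t
  have hcomm : ∀ (f g : ℝ → ℂ) (x : ℂ), turnSign f g x = -1 ↔ turnSign g f x = -1 := by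
    intro f g x
    rw [← turnSign_inv g f, inv_eq_iff_eq_inv]
    norm_num
  have hp : ∀ i, IsPLPath ((![a, b, c] : Fin 3 → Path A B) i) := by
    intro i
    fin_cases i <;> assumption
  have hj : JoinedIn {x | StronglySheltered a b c x} A B := by
    refine joinedIn_of_pairSign hgen hp ?_ ?_ ?_ ?_
    · exact Or.inl ⟨⟨0, a.source⟩, ⟨0, b.source⟩⟩
    · exact Or.inl ⟨⟨1, a.target⟩, ⟨1, b.target⟩⟩
    · rintro i s ⟨-, j, hij, t, -, e⟩
      have h1 := hmem (![a, b, c] i) s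
      have h2 := hmem (![a, b, c] j) t
      rw [← e] at h2
      generalize ((![a, b, c] : Fin 3 → Path A B) i).extend s = x at h1 h2 ⊢
      clear e
      fin_cases i <;> fin_cases j <;> first
        | exact absurd rfl hij
        | exact Or.inl ⟨h1, h2⟩
        | exact Or.inl ⟨h2, h1⟩
        | exact Or.inr (Or.inl ⟨h1, h2⟩)
        | exact Or.inr (Or.inl ⟨h2, h1⟩)
        | exact Or.inr (Or.inr (Or.inl ⟨h1, h2⟩))
        | exact Or.inr (Or.inr (Or.inl ⟨h2, h1⟩))
    · intro i s hs hK
      have h1 := hmem (![a, b, c] i) s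
      have hn : ∀ j, j ≠ i → (![a, b, c] i).extend s ∉ Set.range (![a, b, c] j) := by
        intro j hj hr
        obtain ⟨t, ht, e⟩ := (hrange _ _).1 hr
        exact hK ⟨hs, j, hj, t, ht, e⟩
      rw [pairSign]
      have n1 := hn (i + 1) (fin_three_add_one_ne i)
      have n2 := hn (i + 2) (fin_three_add_two_ne i)
      have hiff := exists_odd_hasWindingNumber_iff n1 n2
      have hiff' := exists_odd_hasWindingNumber_iff n2 n1
      rw [hcomm] at hiff'
      rw [← hiff]
      have hsw := hiff'.trans hiff.symm
      clear hiff hiff' hn hK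
      generalize ((![a, b, c] : Fin 3 → Path A B) i).extend s = x at *
      have hodd : ∀ q r t : Path A B, OddlyEnclosedOn q r t x ↔
          x ∈ Set.range q ∧ x ∉ Set.range r ∧ x ∉ Set.range t ∧
            ∃ k : ℤ, Odd k ∧ HasWindingNumber (loopOf r t) x k := fun q r t => Iff.rfl
      fin_cases i
      · change x ∈ Set.range a at h1
        change x ∉ Set.range b at n1
        change x ∉ Set.range c at n2
        change StronglySheltered a b c x ↔ ∃ k, Odd k ∧ HasWindingNumber (loopOf b c) x k
        simp only [StronglySheltered, hodd, h1, n1, n2, not_true_eq_false, not_false_eq_true,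
          true_and, false_and, and_false, or_false, false_or]
      · change x ∈ Set.range b at h1
        change x ∉ Set.range c at n1
        change x ∉ Set.range a at n2
        change StronglySheltered a b c x ↔ ∃ k, Odd k ∧ HasWindingNumber (loopOf c a) x k
        refine Iff.trans ?_ hsw
        change StronglySheltered a b c x ↔ ∃ k, Odd k ∧ HasWindingNumber (loopOf a c) x k
        simp only [StronglySheltered, hodd, h1, n1, n2, not_true_eq_false, not_false_eq_true,
          true_and, false_and, and_false, or_false, false_or]
      · change x ∈ Set.range c at h1
        change x ∉ Set.range a at n1
        change x ∉ Set.range b at n2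
        change StronglySheltered a b c x ↔ ∃ k, Odd k ∧ HasWindingNumber (loopOf a b) x k
        simp only [StronglySheltered, hodd, h1, n1, n2, not_true_eq_false, not_false_eq_true,
          true_and, false_and, and_false, false_or]
  refine ⟨hj.somePath, fun t => ?_⟩
  have ht : StronglySheltered a b c (hj.somePath t) := hj.somePath_mem t
  refine ⟨?_, ht⟩
  rcases ht with h | h | h | h | h | h
  · exact Or.inl (Or.inl h.1)
  · exact Or.inl (Or.inr h.1)
  · exact Or.inl (Or.inl h.1)
  · exact Or.inl (Or.inl h.1)
  · exact Or.inl (Or.inr h.1)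
  · exact Or.inr h.1
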